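/- **Setting.** A metrical task system (MTS) consists of a metric space $(M,d)$ of finite diameter $D=\sup_{s,s'\in M}d(s,s')$, a starting point $s_0\in M$, and cost functions $c_1,\dots,c_T\colon M\to[0,+\infty]$; at time $t$ an algorithm sees $c_t$, moves from $s_{t-1}$ to a state $s_t$ and pays $c_t(s_t)+d(s_{t-1},s_t)$. There are $\ell\ge 2$ heuristics $H_1,\dots,H_\ell$; $H_i$ is in state $s^i_t$ at time $t$, and $s^i_0=s_0$. The cost functions and the states of the heuristics are fixed in advance (oblivious adversary). The cost of $H_i$ at time $t$ is $f_t(i)=c_t(s^i_t)+d(s^i_{t-1},s^i_t)$, it is assumed that $f_t(i)\in[0,2D]$, and $\mathrm{OPT}_{\le 0}=\min_{i}\sum_{t=1}^T f_t(i)$. For $m\ge 2$, $m$-delayed bandit access means that one heuristic may be queried at each time $t\geq 1$, and that the answer to a query of $H_i$ at time $t$ is $s^i_t$ if $H_i$ was queried in all the steps $t-m+2,\dots,t$, and is empty otherwise. **Algorithm**, with parameters $\epsilon,\eta$. Let $\beta_0=0$, let $\beta_1,\beta_2,\dots\sim\mathrm{Bernoulli}(\epsilon)$ and $e_1,e_2,\dots\sim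 U(\{1,\dots,\ell\})$ be independent. Time $0$ is an exploitation step. If $t$ is an exploitation step with $\beta_t=0$, then $t+1$ is an exploitation step; if $\beta_t=1$, then $H_{e_{t+m}}$ is queried in steps $t+1,\dots,t+m$, step $t+m$ is an exploration step, and $t+m+1$ is an exploitation step. In an exploration step $t$ set $g_t(e_t)=f_t(e_t)/(2D)$, computed from the answers at times $t-1$ and $t$, and $g_t(i)=0$ for $i\ne e_t$; in all other steps $g_t=0$. The distribution $x_t$ over the heuristics is that of HEDGE with learning rate $\eta$: $x_t(i)=w_t(i)/\sum_j w_t(j)$ with $w_0=1$, $w_{t+1}(i)=w_t(i)e^{-\eta g_t(i)}$. The exploited heuristic $i_0$ is uniform; $i_t=i_{t-1}$ if $x_t=x_{t-1}$, and otherwise $i_t=j$ with probability $\tau_{i_{t-1},j}/x_{t-1}(i_{t-1})$, where $\tau\ge 0$ is any transport plan from $x_{t-1}$ to $x_t$ with $\sum_{i\ne j}\tau_{i,j}=\sum_i\max(0,x_{t-1}(i)-x_t(i))$. In exploitation steps $H_{i_t}$ is queried. If $s^{i_t}_t$ is known from the answer at time $t$, the algorithm goes to $s_t=b_t=s_t^{i_t}$;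 otherwise $b_t=b_{t-1}$ and $s_t\in\arg\min_{s}(d(b_t,s)+c_t(s))$ (a minimizer is assumed to exist; ties are broken by any rule), where $b_0=s_0$. The parameters are $$\epsilon=(D\ell\ln\ell)^{1/3}m^{-4/3}\mathrm{OPT}_{\le 0}^{-1/3},\qquad \gamma=(D\ell\ln\ell)^{1/3}m^{2/3}\mathrm{OPT}_{\le 0}^{-1/3},\qquad \eta=-\ln(1-\gamma).$$ **Theorem.** Let $D$ be bounded away from $0$ and $D\ell m= o(\mathrm{OPT}_{\le 0}^{1/3})$. Then the expected cost of this algorithm satisfies $$\mathbb E[\mathrm{ALG}]\le \mathrm{OPT}_{\le 0}+O\big((D\ell\ln\ell)^{1/3}m^{2/3}\,\mathrm{OPT}_{\le 0}^{2/3}\big).$$ Precisely: there is an absolute constant $C>0$ such that for every $D_0>0$ there is $\kappa>0$ such that for all $\ell,m\ge 2$ and all instances as above with $D\ge D_0$ and $D\ell m\le\kappa\,\mathrm{OPT}_{\le 0}^{1/3}$, we have $0<\epsilon<1$, $0<\gamma<1$, and $\mathbb E[\mathrm{ALG}]\le\mathrm{OPT}_{\le 0}+C\,(D\ell\ln\ell)^{1/3}m^{2/3}\,\mathrm{OPT}_{\le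 0}^{2/3}$. -/

import Mathlib

open scoped ENNReal

noncomputable section

namespace BanditMTS

/-- An input of a metrical task system with `ℓ` heuristics, fixed in advance by an oblivious
adversary: horizon `T`, starting point `s₀`, cost functions `c 1, …, c T` with values in
`[0, ∞]`, and the state `H i t` of the heuristic `i` at time `t`. All heuristics start in `s₀`. -/
structure Instance (M : Type*) (ℓ : ℕ) where
  T : ℕ
  s₀ : M
  c : ℕ → M → ℝ≥0∞
  H : Fin ℓ → ℕ → M
  H_zero : ∀ i, H i 0 = s₀

/-- The cost `f_t(i) = c_t(s_t^i) + d(s_{t-1}^i, s_t^i)` paid by the heuristic `i` at time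
`t ≥ 1`. -/
def Instance.f {M : Type*} [MetricSpace M] {ℓ : ℕ} (I : Instance M ℓ) (t : ℕ) (i : Fin ℓ) :
    ℝ≥0∞ :=
  I.c t (I.H i t) + edist (I.H i (t - 1)) (I.H i t)

/-- `OPT_{≤ 0}`, the total cost of the best single heuristic. -/
def Instance.opt {M : Type*} [MetricSpace M] {ℓ : ℕ} (I : Instance M ℓ) : ℝ≥0∞ :=
  ⨅ i : Fin ℓ, ∑ t ∈ Finset.Icc 1 I.T, I.f t i

/-- `m`-delayed bandit access. Exactly one heuristic `q t` is queried at each time `t ≥ 1`. The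
answer at time `t` is the current state of `q t` if `q t` was queried in all the steps
`t - m + 2, …, t` (which must be steps `≥ 1`), and it is empty otherwise. -/
def answer {M : Type*} {ℓ : ℕ} (m : ℕ) (H : Fin ℓ → ℕ → M) (q : ℕ → Fin ℓ) (t : ℕ) : Option M :=
  open Classical in
  if m ≤ t + 1 ∧ ∀ u ≤ t, t + 2 ≤ u + m → q u = q t then some (H (q t) t) else none

/-! ### The learning dynamics

The algorithm uses the heuristics only through the stream `a : ℕ → Option M` of answers. -/

/-- `timer m β t` is `0` if `t` is an exploitation step. If `u` is an exploitation step with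
`β u = true`, the steps `u + 1, …, u + m` have timers `m, m - 1, …, 1`; the last of them, the one
with timer `1`, is the exploration step, and `u + m + 1` is an exploitation step again. -/
def timer (m : ℕ) (β : ℕ → Bool) : ℕ → ℕ
  | 0 => 0
  | t + 1 => if timer m β t = 0 then (if β t then m else 0) else timer m β t - 1

/-- The queried heuristic: the exploited heuristic `i t` in an exploitation step, and otherwise
the heuristic `e u`, where `u = t + timer t - 1` is the upcoming (or present) exploration step. -/
def query {ℓ : ℕ} (m : ℕ) (β : ℕ → Bool) (e i : ℕ → Fin ℓ) (t : ℕ) : Fin ℓ :=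
  if timer m β t = 0 then i t else e (t + timer m β t - 1)

/-- The loss vector `g_t` fed to the full-feedback learner. In an exploration step, the coordinate
of the explored heuristic is its observed cost divided by `2 D`, computed from its states at times
`t - 1` and `t`; everything else is zero. -/
def loss {M : Type*} [MetricSpace M] {ℓ : ℕ} (D : ℝ) (c : ℕ → M → ℝ≥0∞) (r : ℕ → ℕ)
    (q : ℕ → Fin ℓ) (a : ℕ → Option M) (t : ℕ) (j : Fin ℓ) : ℝ :=
  if r t = 1 ∧ j = q t then
    match a (t - 1), a t with
    | some y', some y => (c t y + edist y' y).toReal / (2 * D)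
    | _, _ => 0
  else 0

/-- The weights of HEDGE with learning rate `η` for the loss vectors `g 0, g 1, …`. -/
def hedgeWeight {ℓ : ℕ} (η : ℝ) (g : ℕ → Fin ℓ → ℝ) : ℕ → Fin ℓ → ℝ
  | 0 => fun _ => 1
  | t + 1 => fun j => hedgeWeight η g t j * Real.exp (-η * g t j)

/-- The distribution `x_t` over the heuristics chosen by HEDGE after seeing the losses
`g 0, …, g (t - 1)`. It does not change after a step with `g = 0`. -/
def hedge {ℓ : ℕ} (η : ℝ) (g : ℕ → Fin ℓ → ℝ) (t : ℕ) (j : Fin ℓ) : ℝ :=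
  hedgeWeight η g t j / ∑ k, hedgeWeight η g t k

/-! ### Producing a solution -/

/-- The procedure Round: `R p p' i` is the law of the new index if the old index is `i`. It moves
from `i` to `j` with probability `τ i j / p i`, where `τ` is an optimal way of transferring the
mass of the distribution `p` to `p'`, i.e. the mass moved is `∑ i, max 0 (p i - p' i)`. -/
def IsRound {ℓ : ℕ} (R : (Fin ℓ → ℝ) → (Fin ℓ → ℝ) → Fin ℓ → PMF (Fin ℓ)) : Prop :=
  ∀ p ∈ stdSimplex ℝ (Fin ℓ), ∀ p' ∈ stdSimplex ℝ (Fin ℓ), ∃ τ : Fin ℓ → Fin ℓ → ℝ,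
    (∀ i j, 0 ≤ τ i j) ∧ (∀ i, ∑ j, τ i j = p i) ∧ (∀ j, ∑ i, τ i j = p' j) ∧
    ∑ i, ∑ j ∈ Finset.univ.erase i, τ i j = ∑ i, max 0 (p i - p' i) ∧
    ∀ i, p i ≠ 0 → ∀ j, R p p' i j = ENNReal.ofReal (τ i j / p i)

/-- `greedy t b` is a point of `argmin_s (d(b, s) + c_t(s))`, for any way of breaking ties. -/
def IsGreedy {M : Type*} [MetricSpace M] {ℓ : ℕ} (I : Instance M ℓ) (greedy : ℕ → M → M) : Prop :=
  ∀ t ∈ Finset.Icc 1 I.T, ∀ b s : M,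
    edist b (greedy t b) + I.c t (greedy t b) ≤ edist b s + I.c t s

/-- The state of the exploited heuristic `i t` at time `t`, if it is known. -/
def known {M : Type*} {ℓ : ℕ} (q i : ℕ → Fin ℓ) (a : ℕ → Option M) (t : ℕ) : Option M :=
  if q t = i t then a t else none

/-- The last known state `b_t` of an exploited heuristic. -/
def lastKnown {M : Type*} {ℓ : ℕ} (s₀ : M) (q i : ℕ → Fin ℓ) (a : ℕ → Option M) : ℕ → M
  | 0 => s₀
  | t + 1 => (known q i a (t + 1)).getD (lastKnown s₀ q i a t)

/-- The state `s_t` of the algorithm: the state of the exploited heuristic if it is known, and a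
greedy step from `b_t` otherwise. -/
def position {M : Type*} {ℓ : ℕ} (s₀ : M) (greedy : ℕ → M → M) (q i : ℕ → Fin ℓ)
    (a : ℕ → Option M) : ℕ → M
  | 0 => s₀
  | t + 1 => (known q i a (t + 1)).getD (greedy (t + 1) (lastKnown s₀ q i a (t + 1)))

/-! ### The random choices

A realization consists of the coins `β`, the explored heuristics `e` and the exploited heuristics
`i`. Given these three sequences, the run of the algorithm is determined. -/

/-- The answers received by the algorithm. -/
def Instance.answers {M : Type*} {ℓ : ℕ} (I : Instance M ℓ) (m : ℕ) (β : ℕ → Bool)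
    (e i : ℕ → Fin ℓ) : ℕ → Option M :=
  answer m I.H (query m β e i)

/-- The distributions `x_0, x_1, …` over the heuristics. -/
def Instance.dist {M : Type*} [MetricSpace M] {ℓ : ℕ} (I : Instance M ℓ) (D : ℝ) (m : ℕ) (η : ℝ)
    (β : ℕ → Bool) (e i : ℕ → Fin ℓ) : ℕ → Fin ℓ → ℝ :=
  hedge η (loss D I.c (timer m β) (query m β e i) (I.answers m β e i))

/-- The cost of the algorithm. -/
def Instance.cost {M : Type*} [MetricSpace M] {ℓ : ℕ} (I : Instance M ℓ) (greedy : ℕ → M → M)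
    (m : ℕ) (β : ℕ → Bool) (e i : ℕ → Fin ℓ) : ℝ≥0∞ :=
  let s := position I.s₀ greedy (query m β e i) i (I.answers m β e i)
  ∑ t ∈ Finset.Icc 1 I.T, (I.c t (s t) + edist (s (t - 1)) (s t))

/-- The probability of the coins: `β 0 = 0`, and `β 1, …, β T` are independent with
`P(β t = 1) = ε`. -/
def coinProb (T : ℕ) (ε : ℝ) (β : ℕ → Bool) : ℝ≥0∞ :=
  if β 0 then 0 else
    ∏ t ∈ Finset.Icc 1 T, if β t then ENNReal.ofReal ε else ENNReal.ofReal (1 - ε)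

/-- The conditional probability of `i 0, …, i T` given `β` and `e`: `i 0` is uniform, and `i t` is
drawn by `Round(i (t - 1), x (t - 1), x t)` if `x t ≠ x (t - 1)` and equal to `i (t - 1)`
otherwise. -/
def pathProb {ℓ : ℕ} (R : (Fin ℓ → ℝ) → (Fin ℓ → ℝ) → Fin ℓ → PMF (Fin ℓ)) (T : ℕ)
    (x : ℕ → Fin ℓ → ℝ) (i : ℕ → Fin ℓ) : ℝ≥0∞ :=
  open Classical in
  (ℓ : ℝ≥0∞)⁻¹ * ∏ t ∈ Finset.Icc 1 T,
    if x t ≠ x (t - 1) then R (x (t - 1)) (x t) (i (t - 1)) (i t)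
    else if i t = i (t - 1) then 1 else 0

/-- Extension of a finite sequence to `ℕ`; only the values at `0, …, n` are relevant. -/
def ext {α : Type*} {n : ℕ} (u : Fin (n + 1) → α) (t : ℕ) : α := u (Fin.ofNat (n + 1) t)

/-- The expected cost of the algorithm with exploration rate `ε` and HEDGE with learning rate `η`.
The sequence `e` is uniform and independent of `β`. It has `T + m` terms (and a dummy term `e 0`)
since an exploration block can begin before time `T` and end after it. -/
def Instance.expectedCost {M : Type*} [MetricSpace M] {ℓ : ℕ} (I : Instance M ℓ)
    (greedy : ℕ → M → M) (R : (Fin ℓ → ℝ) → (Fin ℓ → ℝ) → Fin ℓ → PMF (Fin ℓ))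
    (D : ℝ) (m : ℕ) (ε η : ℝ) : ℝ≥0∞ :=
  ∑ β : Fin (I.T + 1) → Bool, ∑ e : Fin (I.T + m + 1) → Fin ℓ, ∑ i : Fin (I.T + 1) → Fin ℓ,
    coinProb I.T ε (ext β) * ((ℓ : ℝ≥0∞)⁻¹) ^ (I.T + m + 1) *
      pathProb R I.T (I.dist D m η (ext β) (ext e) (ext i)) (ext i) *
      I.cost greedy m (ext β) (ext e) (ext i)

/-- The exploration rate `ε = (D ℓ ln ℓ)^{1/3} m^{-4/3} OPT^{-1/3}`. -/
def epsParam (D : ℝ) (ℓ m : ℕ) (opt : ℝ) : ℝ :=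
  (D * ℓ * Real.log ℓ) ^ (1 / 3 : ℝ) * (m : ℝ) ^ (-4 / 3 : ℝ) * opt ^ (-1 / 3 : ℝ)

/-- `γ = (D ℓ ln ℓ)^{1/3} m^{2/3} OPT^{-1/3}`. -/
def gammaParam (D : ℝ) (ℓ m : ℕ) (opt : ℝ) : ℝ :=
  (D * ℓ * Real.log ℓ) ^ (1 / 3 : ℝ) * (m : ℝ) ^ (2 / 3 : ℝ) * opt ^ (-1 / 3 : ℝ)

/-- The learning rate `η` of HEDGE, given by `γ = 1 - exp (-η)`. -/
def etaParam (D : ℝ) (ℓ m : ℕ) (opt : ℝ) : ℝ := -Real.log (1 - gammaParam D ℓ m opt)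

end BanditMTS

end

open scoped ENNReal

noncomputable section

namespace BanditMTS

/-! ### Timers -/

/-! The proof splits into a pathwise comparison and a computation of expectations.

Pathwise, let F_t be the cost of the exploited heuristic at time t, plus D if a switch occurs. The
answer about this heuristic can be missing only in a stale step. During a run of stale steps the
base point b_t stays put while the target moves, so their distance is at most the sum of F over the
run, the `backlog`. Comparing the greedy step with the target and travelling through b_t bounds a
run by the sum of F_t + 2 · backlog (`cost_le`).

Given β and e, the losses fed to HEDGE do not depend on the exploited heuristics
(`loss_eq_explorationLoss`). Hence i is a Markov chain with marginals x_t, and it switches with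
probability equal to the mass moved (`pathExpect_apply`, `pathExpect_switch`). Staleness depends on
β alone, so averaging over i commutes with forming the backlog.

It remains to average over β and e. The explored index is uniform and independent of x_t, so up to
the factor 1/(2Dℓ) a HEDGE loss samples the cost of x_t in exploration steps. That the step is an
exploration step is not independent of x_t. However, x changes at most once in m + 1 consecutive
steps, by a factor between exp(-η) and exp(η), so x_t may be replaced by an earlier distribution
which the relevant coin cannot influence. This gives `expect_exploration_meanCost_ge`, and with the
regret bound of HEDGE the mean cost is OPT + O(γ OPT). A stale step needs a successful coin among
the last 2m, or is one of the first steps; the same decoupling bounds the total backlog by about m²ε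
OPT = γ OPT (`sum_expect_backlog_le`). The parameters satisfy γ = m²ε and γ³ OPT = D ℓ (ln ℓ) m²,
which makes the HEDGE regret, of order Dℓ(ln ℓ)/(γε), also of order γ OPT; `total_cost_le` does this
arithmetic. -/

theorem timer_congr {m : ℕ} {β β' : ℕ → Bool} {t : ℕ} (h : ∀ u < t, β u = β' u) :
    timer m β t = timer m β' t := by
  induction t with
  | zero => rfl
  | succ t ih =>
    rw [timer, timer, ih fun u hu => h u (by omega), h t (by omega)]

/-- Along an exploration block, time plus timer is constant, so it identifies the coin that opened
the block. -/
theorem exists_start_of_timer_ne_zero {m : ℕ} {β : ℕ → Bool} {t : ℕ} (h : timer m β t ≠ 0) :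
    ∃ s < t, t + timer m β t = s + m + 1 ∧ timer m β s = 0 ∧ β s = true := by
  induction t with
  | zero => exact absurd rfl h
  | succ t ih =>
    by_cases h0 : timer m β t = 0
    · have hb : β t = true := by
        by_contra hb
        simp [timer, h0, hb] at h
      refine ⟨t, by omega, ?_, h0, hb⟩
      simp [timer, h0, hb]
      omega
    · obtain ⟨s, hs, he, h1, h2⟩ := ih h0
      refine ⟨s, by omega, ?_, h1, h2⟩
      simp only [timer, h0, if_false] at h ⊢
      omega

theorem timer_start_add {m : ℕ} {β : ℕ → Bool} {s : ℕ} (h0 : timer m β s = 0)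
    (hb : β s = true) {k : ℕ} (hk : k < m) : timer m β (s + k + 1) = m - k := by
  induction k with
  | zero => simp [timer, h0, hb]
  | succ k ih =>
    have := ih (by omega)
    rw [← add_assoc, timer, this, if_neg (by omega)]
    omega

theorem timer_eq_one_iff {m : ℕ} (hm : 1 ≤ m) {β : ℕ → Bool} {s : ℕ} :
    timer m β (s + m) = 1 ↔ timer m β s = 0 ∧ β s = true := by
  constructor
  · intro h
    obtain ⟨u, -, h1, h2⟩ := exists_start_of_timer_ne_zero (by rw [h]; exact one_ne_zero)
    obtain rfl : u = s := by omega
    exact h2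
  · rintro ⟨h1, h2⟩
    have := timer_start_add h1 h2 (k := m - 1) (by omega)
    rw [show s + (m - 1) + 1 = s + m by omega] at this
    omega

theorem exists_coin_of_timer_ne_zero {m : ℕ} {β : ℕ → Bool} {t : ℕ} (h : timer m β t ≠ 0) :
    ∃ s ∈ Finset.Ico (t - m) t, β s = true := by
  obtain ⟨s, h1, h2, -, h3⟩ := exists_start_of_timer_ne_zero h
  exact ⟨s, Finset.mem_Ico.2 ⟨by omega, h1⟩, h3⟩

theorem timer_sub_of_timer_eq_one {m : ℕ} {β : ℕ → Bool} {t : ℕ} (h : timer m β t = 1)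
    {k : ℕ} (hk : k < m) : timer m β (t - k) = k + 1 ∧ m ≤ t := by
  obtain ⟨s, h1, h2, h3, h4⟩ := exists_start_of_timer_ne_zero (by rw [h]; exact one_ne_zero)
  have := timer_start_add h3 h4 (k := m - 1 - k) (by omega)
  rw [show s + (m - 1 - k) + 1 = t - k by omega] at this
  omega

/-- Exploration steps are more than `m` steps apart. -/
theorem exploration_spacing {m : ℕ} {β : ℕ → Bool} {s t : ℕ} (hs : timer m β s = 1)
    (ht : timer m β t = 1) (hst : s < t) : s + m < t := by
  by_contra hcon
  obtain ⟨u, h1, h2, h3, h4⟩ := exists_start_of_timer_ne_zero (by rw [ht]; exact one_ne_zero)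
  by_cases h : s = u
  · subst h; omega
  · have := timer_start_add h3 h4 (k := s - u - 1) (by omega)
    rw [show u + (s - u - 1) + 1 = s by omega] at this
    omega

/-- This is what makes HEDGE slow: it is updated at most once during m + 1 consecutive steps. -/
theorem card_exploration_le_one {m : ℕ} {β : ℕ → Bool} {s t : ℕ} (hst : t ≤ s + m + 1) :
    ((Finset.Ico s t).filter fun u => timer m β u = 1).card ≤ 1 := by
  rw [Finset.card_le_one]
  intro a ha b hb
  simp only [Finset.mem_filter, Finset.mem_Ico] at ha hb
  by_contra hne
  rcases lt_or_gt_of_ne hne with h | h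
  · have := exploration_spacing ha.2 hb.2 h; omega
  · have := exploration_spacing hb.2 ha.2 h; omega

/-! ### Stale steps -/

/-- The answer at an exploitation step can be empty only if the step is stale: it is among the
first ones, or there was an exploration block within the last `m - 1` steps. -/
def Stale (m : ℕ) (β : ℕ → Bool) (t : ℕ) : Prop :=
  t + 1 < m ∨ ∃ u ≤ t, t + 2 ≤ u + m ∧ timer m β u ≠ 0

theorem stale_congr {m : ℕ} {β β' : ℕ → Bool} {t : ℕ} (h : ∀ u < t, β u = β' u) :
    Stale m β t ↔ Stale m β' t := by
  unfold Stale
  refine or_congr Iff.rfl (exists_congr fun u => and_congr_right fun hu => ?_)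
  rw [timer_congr fun v hv => h v (by omega)]

/-- The window 2m has two sources: the block lies less than m steps back, and its coin at most m
steps before that. -/
theorem Stale.exists_coin {m : ℕ} {β : ℕ → Bool} {t : ℕ} (h : Stale m β t) :
    t + 1 < m ∨ ∃ s ∈ Finset.Ico (t - 2 * m) t, β s = true := by
  rcases h with h | ⟨u, hu, hut, hr⟩
  · exact Or.inl h
  · obtain ⟨s, hs, hb⟩ := exists_coin_of_timer_ne_zero hr
    rw [Finset.mem_Ico] at hs
    exact Or.inr ⟨s, Finset.mem_Ico.2 ⟨by omega, by omega⟩, hb⟩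

open Classical in
/-- The amount accumulated in the current run of stale steps. -/
def backlog (m : ℕ) (β : ℕ → Bool) (F : ℕ → ℝ) : ℕ → ℝ
  | 0 => 0
  | t + 1 => if Stale m β (t + 1) then backlog m β F t + F (t + 1) else 0

theorem backlog_congr {m : ℕ} {β β' : ℕ → Bool} {F F' : ℕ → ℝ} {t : ℕ}
    (h : ∀ u < t, β u = β' u) (hF : ∀ u ≤ t, F u = F' u) :
    backlog m β F t = backlog m β' F' t := by
  induction t with
  | zero => rfl
  | succ t ih =>
    rw [backlog, backlog, ih (fun u hu => h u (by omega)) fun u hu => hF u (by omega),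
      hF _ le_rfl, stale_congr h]

theorem backlog_nonneg {m : ℕ} {β : ℕ → Bool} {F : ℕ → ℝ} (t : ℕ) (hF : ∀ u ≤ t, 0 ≤ F u) :
    0 ≤ backlog m β F t := by
  induction t with
  | zero => exact le_rfl
  | succ t ih =>
    rw [backlog]
    split_ifs
    · exact add_nonneg (ih fun u hu => hF u (by omega)) (hF _ le_rfl)
    · exact le_rfl

/-- A reset only lowers the backlog. The base time s is free, so it can be put before all the coins
of a window. -/
theorem backlog_le_add_sum {m : ℕ} {β : ℕ → Bool} {F : ℕ → ℝ} {s t : ℕ} (hst : s ≤ t)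
    (hF : ∀ u ≤ t, 0 ≤ F u) :
    backlog m β F t ≤ backlog m β F s + ∑ u ∈ Finset.Ioc s t, F u := by
  induction t, hst using Nat.le_induction with
  | base => simp
  | succ t hst ih =>
    have h := ih fun u hu => hF u (by omega)
    have h1 := hF (t + 1) le_rfl
    have h2 := backlog_nonneg (m := m) (β := β) (F := F) s fun u hu => hF u (by omega)
    have h3 : 0 ≤ ∑ u ∈ Finset.Ioc s t, F u :=
      Finset.sum_nonneg fun u hu => hF u (by rw [Finset.mem_Ioc] at hu; omega)
    rw [Finset.sum_Ioc_succ_top (by omega), backlog]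
    split_ifs <;> linarith

theorem backlog_eq_zero {m : ℕ} {β : ℕ → Bool} {F : ℕ → ℝ} {t : ℕ} (h : ¬ Stale m β t) :
    backlog m β F t = 0 := by
  cases t with
  | zero => rfl
  | succ t => rw [backlog, if_neg h]

/-! ### HEDGE -/

section hedge

variable {ℓ : ℕ}

theorem hedgeWeight_succ (η : ℝ) (g : ℕ → Fin ℓ → ℝ) (t : ℕ) (j : Fin ℓ) :
    hedgeWeight η g (t + 1) j = hedgeWeight η g t j * Real.exp (-η * g t j) := rfl

theorem hedgeWeight_pos (η : ℝ) (g : ℕ → Fin ℓ → ℝ) (t : ℕ) (j : Fin ℓ) :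
    0 < hedgeWeight η g t j := by
  induction t with
  | zero => exact one_pos
  | succ t ih => exact mul_pos ih (Real.exp_pos _)

theorem hedgeWeight_congr {η : ℝ} {g g' : ℕ → Fin ℓ → ℝ} {t : ℕ} (h : ∀ u < t, g u = g' u) :
    hedgeWeight η g t = hedgeWeight η g' t := by
  induction t with
  | zero => rfl
  | succ t ih =>
    ext j
    rw [hedgeWeight, hedgeWeight, ih fun u hu => h u (by omega), h t (by omega)]

theorem hedge_congr {η : ℝ} {g g' : ℕ → Fin ℓ → ℝ} {t : ℕ} (h : ∀ u < t, g u = g' u) :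
    hedge η g t = hedge η g' t := by
  ext j
  rw [hedge, hedge, hedgeWeight_congr h]

theorem sum_hedgeWeight_pos [NeZero ℓ] (η : ℝ) (g : ℕ → Fin ℓ → ℝ) (t : ℕ) :
    0 < ∑ k, hedgeWeight η g t k :=
  Finset.sum_pos (fun k _ => hedgeWeight_pos η g t k) Finset.univ_nonempty

theorem hedge_pos [NeZero ℓ] (η : ℝ) (g : ℕ → Fin ℓ → ℝ) (t : ℕ) (j : Fin ℓ) :
    0 < hedge η g t j :=
  div_pos (hedgeWeight_pos η g t j) (sum_hedgeWeight_pos η g t)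

theorem sum_hedge [NeZero ℓ] (η : ℝ) (g : ℕ → Fin ℓ → ℝ) (t : ℕ) : ∑ j, hedge η g t j = 1 := by
  simp only [hedge]
  rw [← Finset.sum_div, div_self (sum_hedgeWeight_pos η g t).ne']

theorem hedge_mem_stdSimplex [NeZero ℓ] (η : ℝ) (g : ℕ → Fin ℓ → ℝ) (t : ℕ) :
    hedge η g t ∈ stdSimplex ℝ (Fin ℓ) :=
  ⟨fun j => (hedge_pos η g t j).le, sum_hedge η g t⟩

theorem hedge_zero [NeZero ℓ] (η : ℝ) (g : ℕ → Fin ℓ → ℝ) (j : Fin ℓ) :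
    hedge η g 0 j = (ℓ : ℝ)⁻¹ := by
  simp [hedge, hedgeWeight]

theorem hedge_succ_of_eq_zero {η : ℝ} {g : ℕ → Fin ℓ → ℝ} {t : ℕ} (h : ∀ j, g t j = 0) :
    hedge η g (t + 1) = hedge η g t := by
  ext j
  simp [hedge, hedgeWeight, h]

theorem sum_hedgeWeight_succ_le {η : ℝ} {g : ℕ → Fin ℓ → ℝ} {t : ℕ}
    (hη : 0 ≤ η) (hg : ∀ j, 0 ≤ g t j) :
    ∑ k, hedgeWeight η g (t + 1) k ≤ ∑ k, hedgeWeight η g t k := by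
  refine Finset.sum_le_sum fun k _ => ?_
  rw [hedgeWeight]
  refine mul_le_of_le_one_right (hedgeWeight_pos η g t k).le (Real.exp_le_one_iff.2 ?_)
  have := mul_nonneg hη (hg k)
  linarith

/-! ### One update of HEDGE -/

section step

variable [NeZero ℓ] {η : ℝ} {g : ℕ → Fin ℓ → ℝ} {t : ℕ}

theorem hedge_mul_exp_le_succ (hη : 0 ≤ η) (hg : ∀ j, 0 ≤ g t j) (j : Fin ℓ) :
    hedge η g t j * Real.exp (-η * g t j) ≤ hedge η g (t + 1) j := by
  rw [hedge, hedge, div_mul_eq_mul_div, ← hedgeWeight_succ]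
  exact div_le_div_of_nonneg_left (hedgeWeight_pos η g _ j).le (sum_hedgeWeight_pos η g _)
    (sum_hedgeWeight_succ_le hη hg)

theorem exp_neg_mul_hedge_le_succ (hη : 0 ≤ η) (hg : ∀ j, 0 ≤ g t j) (hg1 : ∀ j, g t j ≤ 1)
    (j : Fin ℓ) : Real.exp (-η) * hedge η g t j ≤ hedge η g (t + 1) j := by
  refine le_trans ?_ (hedge_mul_exp_le_succ hη hg j)
  rw [mul_comm]
  refine mul_le_mul_of_nonneg_left (Real.exp_le_exp.2 ?_) (hedge_pos η g t j).le
  nlinarith [mul_le_mul_of_nonneg_left (hg1 j) hη]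

/-- No weight increases, and the normalizer shrinks by a factor of at least exp(-η). -/
theorem exp_neg_mul_hedge_succ_le (hη : 0 ≤ η) (hg : ∀ j, 0 ≤ g t j) (hg1 : ∀ j, g t j ≤ 1)
    (j : Fin ℓ) : Real.exp (-η) * hedge η g (t + 1) j ≤ hedge η g t j := by
  rw [hedge, hedge, ← mul_div_assoc, div_le_div_iff₀ (sum_hedgeWeight_pos η g _)
    (sum_hedgeWeight_pos η g _)]
  have h1 : hedgeWeight η g (t + 1) j ≤ hedgeWeight η g t j := by
    rw [hedgeWeight]
    refine mul_le_of_le_one_right (hedgeWeight_pos η g t j).le (Real.exp_le_one_iff.2 ?_)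
    have := mul_nonneg hη (hg j)
    linarith
  have h2 : Real.exp (-η) * ∑ k, hedgeWeight η g t k ≤ ∑ k, hedgeWeight η g (t + 1) k := by
    rw [Finset.mul_sum]
    refine Finset.sum_le_sum fun k _ => ?_
    rw [hedgeWeight, mul_comm]
    refine mul_le_mul_of_nonneg_left (Real.exp_le_exp.2 ?_) (hedgeWeight_pos η g t k).le
    nlinarith [mul_le_mul_of_nonneg_left (hg1 k) hη]
  calc _ = hedgeWeight η g (t + 1) j * (Real.exp (-η) * ∑ k, hedgeWeight η g t k) := by ring
    _ ≤ _ := mul_le_mul h1 h2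
      (mul_nonneg (Real.exp_pos _).le (sum_hedgeWeight_pos η g _).le) (hedgeWeight_pos η g _ _).le

/-- The mass moved by HEDGE in one step. -/
theorem sum_max_hedge_sub_le (hη : 0 ≤ η) (hg : ∀ j, 0 ≤ g t j) :
    ∑ j, max 0 (hedge η g t j - hedge η g (t + 1) j) ≤ η * ∑ j, hedge η g t j * g t j := by
  rw [Finset.mul_sum]
  refine Finset.sum_le_sum fun j _ => max_le ?_ ?_
  · exact mul_nonneg hη (mul_nonneg (hedge_pos η g t j).le (hg j))
  · have h1 := hedge_mul_exp_le_succ hη hg j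
    -- The relative loss of mass is at most 1 - exp(-η g) ≤ η g.
    have h2 := Real.add_one_le_exp (-η * g t j)
    have h3 := mul_le_mul_of_nonneg_left h2 (hedge_pos η g t j).le
    linarith

/-- The chord of the convex function exp between -η and 0. Its slope 1 - exp(-η) is exactly the
parameter γ. -/
theorem exp_neg_mul_le {η y : ℝ} (h0 : 0 ≤ y) (h1 : y ≤ 1) :
    Real.exp (-η * y) ≤ 1 - (1 - Real.exp (-η)) * y := by
  have := convexOn_exp.2 (Set.mem_univ (-η)) (Set.mem_univ 0) h0 (sub_nonneg.2 h1)
    (add_sub_cancel _ _)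
  simp only [smul_eq_mul, mul_zero, add_zero, Real.exp_zero, mul_one] at this
  rw [mul_comm] at this
  linarith

theorem sum_hedgeWeight_succ_le_exp (hg : ∀ j, 0 ≤ g t j) (hg1 : ∀ j, g t j ≤ 1) :
    ∑ k, hedgeWeight η g (t + 1) k ≤ (∑ k, hedgeWeight η g t k) *
      Real.exp (-(1 - Real.exp (-η)) * ∑ j, hedge η g t j * g t j) := by
  set W := ∑ k, hedgeWeight η g t k with hW
  have hWpos : 0 < W := sum_hedgeWeight_pos η g t
  have h1 : ∑ k, hedgeWeight η g (t + 1) k ≤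
      W * (1 - (1 - Real.exp (-η)) * ∑ j, hedge η g t j * g t j) := by
    have : W * (1 - (1 - Real.exp (-η)) * ∑ j, hedge η g t j * g t j) =
        ∑ k, hedgeWeight η g t k * (1 - (1 - Real.exp (-η)) * g t k) := by
      have h2 : W * ∑ j, hedge η g t j * g t j = ∑ j, hedgeWeight η g t j * g t j := by
        rw [Finset.mul_sum]
        refine Finset.sum_congr rfl fun j _ => ?_
        rw [hedge, ← hW]
        field_simp
      rw [mul_sub, mul_one, mul_left_comm, h2, hW, Finset.mul_sum, ← Finset.sum_sub_distrib]
      exact Finset.sum_congr rfl fun j _ => by ring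
    rw [this]
    exact Finset.sum_le_sum fun k _ => mul_le_mul_of_nonneg_left
      (exp_neg_mul_le (hg k) (hg1 k)) (hedgeWeight_pos η g t k).le
  refine h1.trans (mul_le_mul_of_nonneg_left ?_ hWpos.le)
  have := Real.add_one_le_exp (-(1 - Real.exp (-η)) * ∑ j, hedge η g t j * g t j)
  linarith

end step

theorem hedgeWeight_eq_exp (η : ℝ) (g : ℕ → Fin ℓ → ℝ) (t : ℕ) (j : Fin ℓ) :
    hedgeWeight η g t j = Real.exp (-η * ∑ s ∈ Finset.range t, g s j) := by
  induction t with
  | zero => simp [hedgeWeight]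
  | succ t ih => rw [hedgeWeight_succ, ih, Finset.sum_range_succ, mul_add, Real.exp_add]

/-- The regret bound of HEDGE. -/
theorem hedge_regret [NeZero ℓ] {η : ℝ} {g : ℕ → Fin ℓ → ℝ} (hg : ∀ t j, 0 ≤ g t j)
    (hg1 : ∀ t j, g t j ≤ 1) (n : ℕ) (i : Fin ℓ) :
    (1 - Real.exp (-η)) * ∑ t ∈ Finset.range n, ∑ j, hedge η g t j * g t j ≤
      η * ∑ t ∈ Finset.range n, g t i + Real.log ℓ := by
  -- The total weight is the potential: its decay is governed by the learner's loss, and it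
  -- dominates the weight of any single heuristic.
  have h1 : ∑ k, hedgeWeight η g n k ≤ ℓ *
      Real.exp (-(1 - Real.exp (-η)) * ∑ t ∈ Finset.range n, ∑ j, hedge η g t j * g t j) := by
    induction n with
    | zero => simp [hedgeWeight]
    | succ n ih =>
      refine (sum_hedgeWeight_succ_le_exp (hg n) (hg1 n)).trans ?_
      rw [Finset.sum_range_succ, mul_add, Real.exp_add, ← mul_assoc]
      exact mul_le_mul_of_nonneg_right ih (Real.exp_pos _).le
  have h2 : hedgeWeight η g n i ≤ ∑ k, hedgeWeight η g n k :=
    Finset.single_le_sum (fun k _ => (hedgeWeight_pos η g n k).le) (Finset.mem_univ i)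
  rw [hedgeWeight_eq_exp] at h2
  have hℓ : (0 : ℝ) < ℓ := Nat.cast_pos.2 (NeZero.pos ℓ)
  have h3 := Real.log_le_log (Real.exp_pos _) (h2.trans h1)
  rw [Real.log_exp, Real.log_mul hℓ.ne' (Real.exp_pos _).ne', Real.log_exp] at h3
  linarith

end hedge

section

variable {ℓ : ℕ}

/-! ### Expectation over the coins and the explored heuristics -/

/-- In a product of finite probability spaces, a function of one coordinate is independent of a
function of the other ones. -/
theorem sum_prod_weight_mul {ι α : Type*} [Fintype ι] [DecidableEq ι] [Fintype α]
    (w : ι → α → ℝ) (s : ι) (hw : ∑ a, w s a = 1) (φ : α → ℝ) (G : (ι → α) → ℝ)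
    (hG : ∀ u a, G (Function.update u s a) = G u) :
    ∑ u : ι → α, (∏ k, w k (u k)) * (φ (u s) * G u) =
      (∑ a, w s a * φ a) * ∑ u : ι → α, (∏ k, w k (u k)) * G u := by
  have hprod : ∀ (u : ι → α) (a : α), (∏ k, w k (Function.update u s a k)) * w s (u s) =
      (∏ k, w k (u k)) * w s a := by
    intro u a
    rw [← Finset.mul_prod_erase _ _ (Finset.mem_univ s),
      ← Finset.mul_prod_erase _ (fun k => w k (u k)) (Finset.mem_univ s), Function.update_self]
    have : ∏ k ∈ Finset.univ.erase s, w k (Function.update u s a k) =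
        ∏ k ∈ Finset.univ.erase s, w k (u k) :=
      Finset.prod_congr rfl fun k hk => by rw [Function.update_of_ne (Finset.ne_of_mem_erase hk)]
    rw [this]
    ring
  -- Resampling: adjoin an independent copy of coordinate s and exchange it with the original. This
  -- preserves the product law and does not affect G.
  have hswap : Function.Involutive
      (fun p : (ι → α) × α => (Function.update p.1 s p.2, p.1 s)) := by
    rintro ⟨u, a⟩
    simp
  calc ∑ u : ι → α, (∏ k, w k (u k)) * (φ (u s) * G u)
      = ∑ u : ι → α, ∑ a, (∏ k, w k (u k)) * w s a * (φ (u s) * G u) := by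
        refine Finset.sum_congr rfl fun u _ => ?_
        rw [← Finset.sum_mul, ← Finset.mul_sum, hw, mul_one]
    _ = ∑ p : (ι → α) × α, (∏ k, w k (p.1 k)) * w s p.2 * (φ (p.1 s) * G p.1) :=
        (Fintype.sum_prod_type
          (fun p : (ι → α) × α => (∏ k, w k (p.1 k)) * w s p.2 * (φ (p.1 s) * G p.1))).symm
    _ = ∑ p : (ι → α) × α, (∏ k, w k (p.1 k)) * w s p.2 * (φ p.2 * G p.1) := by
        rw [← Equiv.sum_comp (hswap.toPerm _)
          (fun p : (ι → α) × α => (∏ k, w k (p.1 k)) * w s p.2 * (φ (p.1 s) * G p.1))]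
        refine Finset.sum_congr rfl fun p _ => ?_
        simp only [Function.Involutive.coe_toPerm, Function.update_self, hG, hprod]
    _ = ∑ u : ι → α, ∑ a, (∏ k, w k (u k)) * w s a * (φ a * G u) :=
        Fintype.sum_prod_type
          (fun p : (ι → α) × α => (∏ k, w k (p.1 k)) * w s p.2 * (φ p.2 * G p.1))
    _ = _ := by
        rw [Finset.sum_comm, Finset.sum_mul]
        refine Finset.sum_congr rfl fun a _ => ?_
        rw [Finset.mul_sum]
        exact Finset.sum_congr rfl fun u _ => by ring

theorem sum_prod_weight {ι α : Type*} [Fintype ι] [DecidableEq ι] [Fintype α]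
    (w : ι → α → ℝ) (hw : ∀ s, ∑ a, w s a = 1) : ∑ u : ι → α, ∏ k, w k (u k) = 1 := by
  rw [← Fintype.prod_sum, Finset.prod_eq_one fun s _ => hw s]

theorem ext_apply {α : Type*} {n : ℕ} (u : Fin (n + 1) → α) (k : Fin (n + 1)) :
    ext u k = u k := by
  simp [ext]

theorem ext_update_of_ne {α : Type*} {n : ℕ} (u : Fin (n + 1) → α) {s t : ℕ} (hs : s ≤ n)
    (ht : t ≤ n) (h : t ≠ s) (a : α) :
    ext (Function.update u (Fin.ofNat (n + 1) s) a) t = ext u t := by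
  rw [ext, Function.update_of_ne, ext]
  intro heq
  have := congrArg Fin.val heq
  simp only [Fin.val_ofNat] at this
  rw [Nat.mod_eq_of_lt (by omega), Nat.mod_eq_of_lt (by omega)] at this
  exact h this

/-- The law of the coin at time `s`. -/
def coinWeight (ε : ℝ) (s : ℕ) (b : Bool) : ℝ :=
  if s = 0 then (if b then 0 else 1) else if b then ε else 1 - ε

theorem sum_coinWeight (ε : ℝ) (s : ℕ) : ∑ b, coinWeight ε s b = 1 := by
  by_cases h : s = 0 <;> simp [coinWeight, h]

/-- With a point mass at time 0, the coins have a product law, to which `sum_prod_weight_mul`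
applies. -/
theorem toReal_coinProb {T : ℕ} {ε : ℝ} (h0 : 0 ≤ ε) (h1 : ε ≤ 1) (β : Fin (T + 1) → Bool) :
    (coinProb T ε (ext β)).toReal = ∏ k : Fin (T + 1), coinWeight ε k (β k) := by
  have h2 : ∏ k : Fin (T + 1), coinWeight ε k (β k) =
      ∏ k : Fin (T + 1), (fun t => coinWeight ε t (ext β t)) k :=
    Finset.prod_congr rfl fun k _ => by
      simp only [ext_apply]
  rw [h2, Fin.prod_univ_eq_prod_range (fun t => coinWeight ε t (ext β t)), Finset.prod_range_succ',
    coinProb]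
  by_cases hb : ext β 0 = true
  · simp [hb, coinWeight]
  · have : ∏ t ∈ Finset.Icc 1 T, (if ext β t = true then ENNReal.ofReal ε
        else ENNReal.ofReal (1 - ε)) = ∏ t ∈ Finset.range T, (if ext β (t + 1) = true then
        ENNReal.ofReal ε else ENNReal.ofReal (1 - ε)) := by
      rw [Finset.range_eq_Ico, Finset.prod_Ico_add' (fun t => if ext β t = true then
        ENNReal.ofReal ε else ENNReal.ofReal (1 - ε)) 0 T 1]
      rfl
    rw [if_neg hb, this, ENNReal.toReal_prod]
    simp only [coinWeight, hb, if_true, mul_one, Bool.false_eq_true, if_false]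
    refine Finset.prod_congr rfl fun t _ => ?_
    rw [if_neg (Nat.succ_ne_zero t)]
    split_ifs
    · exact ENNReal.toReal_ofReal h0
    · exact ENNReal.toReal_ofReal (by linarith)

theorem coinProb_ne_top {T : ℕ} {ε : ℝ} (β : ℕ → Bool) : coinProb T ε β ≠ ∞ := by
  rw [coinProb]
  split_ifs
  · exact ENNReal.zero_ne_top
  · refine ENNReal.prod_ne_top fun t _ => ?_
    split_ifs <;> exact ENNReal.ofReal_ne_top

/-- Expectation of a function of the coins and of the explored heuristics. -/
def expect (T m : ℕ) (ε : ℝ) (G : (ℕ → Bool) → (ℕ → Fin ℓ) → ℝ) : ℝ :=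
  ∑ β : Fin (T + 1) → Bool, ∑ e : Fin (T + m + 1) → Fin ℓ,
    (coinProb T ε (ext β)).toReal * (ℓ : ℝ)⁻¹ ^ (T + m + 1) * G (ext β) (ext e)

section expect

variable {T m : ℕ} {ε : ℝ}

theorem expect_mono_of_coin_zero {G G' : (ℕ → Bool) → (ℕ → Fin ℓ) → ℝ}
    (h : ∀ β e, β 0 = false → G β e ≤ G' β e) : expect T m ε G ≤ expect T m ε G' := by
  refine Finset.sum_le_sum fun β _ => Finset.sum_le_sum fun e _ => ?_
  by_cases hb : ext β 0 = true
  · simp [coinProb, hb]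
  · exact mul_le_mul_of_nonneg_left (h _ _ (by simpa using hb)) (by positivity)

theorem expect_mono {G G' : (ℕ → Bool) → (ℕ → Fin ℓ) → ℝ} (h : ∀ β e, G β e ≤ G' β e) :
    expect T m ε G ≤ expect T m ε G' :=
  expect_mono_of_coin_zero fun β e _ => h β e

theorem expect_nonneg {G : (ℕ → Bool) → (ℕ → Fin ℓ) → ℝ} (h : ∀ β e, 0 ≤ G β e) :
    0 ≤ expect T m ε G :=
  Finset.sum_nonneg fun β _ => Finset.sum_nonneg fun e _ => mul_nonneg (by positivity) (h _ _)

theorem expect_add (G G' : (ℕ → Bool) → (ℕ → Fin ℓ) → ℝ) :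
    expect T m ε (fun β e => G β e + G' β e) = expect T m ε G + expect T m ε G' := by
  simp only [expect, mul_add, Finset.sum_add_distrib]

theorem expect_const_mul (a : ℝ) (G : (ℕ → Bool) → (ℕ → Fin ℓ) → ℝ) :
    expect T m ε (fun β e => a * G β e) = a * expect T m ε G := by
  simp only [expect, Finset.mul_sum]
  exact Finset.sum_congr rfl fun β _ => Finset.sum_congr rfl fun e _ => by ring

theorem expect_sub (G G' : (ℕ → Bool) → (ℕ → Fin ℓ) → ℝ) :
    expect T m ε (fun β e => G β e - G' β e) = expect T m ε G - expect T m ε G' := by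
  simp only [expect, mul_sub, Finset.sum_sub_distrib]

theorem expect_sum {ι : Type*} (s : Finset ι) (G : ι → (ℕ → Bool) → (ℕ → Fin ℓ) → ℝ) :
    expect T m ε (fun β e => ∑ k ∈ s, G k β e) = ∑ k ∈ s, expect T m ε (G k) := by
  classical
  induction s using Finset.induction_on with
  | empty => simp [expect]
  | insert a s ha ih => simp only [Finset.sum_insert ha, expect_add, ih]

theorem expect_const [NeZero ℓ] (h0 : 0 ≤ ε) (h1 : ε ≤ 1) (a : ℝ) :
    expect T m ε (fun _ (_ : ℕ → Fin ℓ) => a) = a := by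
  have hℓ : (ℓ : ℝ) ≠ 0 := Nat.cast_ne_zero.2 (NeZero.ne ℓ)
  simp only [expect, Finset.sum_const, Finset.card_univ, Fintype.card_pi, Fintype.card_fin,
    Finset.prod_const, nsmul_eq_mul]
  have h2 : ∀ c : ℝ, ((ℓ ^ (T + m + 1) : ℕ) : ℝ) * (c * (ℓ : ℝ)⁻¹ ^ (T + m + 1) * a) = c * a := by
    intro c
    have : (ℓ : ℝ) ^ (T + m + 1) * (ℓ : ℝ)⁻¹ ^ (T + m + 1) = 1 := by
      rw [← mul_pow, mul_inv_cancel₀ hℓ, one_pow]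
    push_cast
    linear_combination c * a * this
  simp only [h2, toReal_coinProb h0 h1, ← Finset.sum_mul]
  rw [sum_prod_weight (fun (k : Fin (T + 1)) b => coinWeight ε k b) fun s => sum_coinWeight ε s,
    one_mul]

/-- The coin at time `s` is independent of what happened before. -/
theorem expect_coin_mul (h0 : 0 ≤ ε) (h1 : ε ≤ 1) {s : ℕ} (hs : 1 ≤ s) (hsT : s ≤ T)
    {G : (ℕ → Bool) → (ℕ → Fin ℓ) → ℝ}
    (hG : ∀ β β' e, (∀ u < s, β u = β' u) → G β e = G β' e) :
    expect T m ε (fun β e => (if β s then 1 else 0) * G β e) = ε * expect T m ε G := by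
  rw [expect, expect, Finset.sum_comm, Finset.sum_comm, Finset.sum_comm (γ := Fin _ → Bool),
    Finset.sum_comm (γ := Fin _ → Bool), Finset.mul_sum]
  refine Finset.sum_congr rfl fun e _ => ?_
  have key := sum_prod_weight_mul (fun (k : Fin (T + 1)) b => coinWeight ε k b)
    (Fin.ofNat (T + 1) s) (sum_coinWeight ε _) (fun b => if b then 1 else 0)
    (fun β => (ℓ : ℝ)⁻¹ ^ (T + m + 1) * G (ext β) (ext e)) (fun β b => by
      congr 1
      exact hG _ _ _ fun u hu => ext_update_of_ne _ hsT (by omega) (by omega) _)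
  have hval : ∑ a, coinWeight ε (Fin.ofNat (T + 1) s : Fin (T + 1)) a *
      (if a = true then (1 : ℝ) else 0) = ε := by
    have : s % (T + 1) ≠ 0 := by rw [Nat.mod_eq_of_lt (by omega)]; omega
    simp [coinWeight, this]
  rw [hval] at key
  calc _ = _ := Finset.sum_congr rfl fun β _ => by
        rw [toReal_coinProb h0 h1, show β (Fin.ofNat (T + 1) s) = ext β s from rfl]; ring
    _ = _ := key
    _ = _ := by
        congr 1
        exact Finset.sum_congr rfl fun β _ => by rw [toReal_coinProb h0 h1, mul_assoc]

/-- Only an inequality, so that time 0, where the coin always fails, is included; truncated windows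
start there. -/
theorem expect_coin_mul_le (h0 : 0 ≤ ε) (h1 : ε ≤ 1) {s : ℕ} (hsT : s ≤ T)
    {G : (ℕ → Bool) → (ℕ → Fin ℓ) → ℝ} (hG0 : ∀ β e, 0 ≤ G β e)
    (hG : ∀ β β' e, (∀ u < s, β u = β' u) → G β e = G β' e) :
    expect T m ε (fun β e => (if β s then 1 else 0) * G β e) ≤ ε * expect T m ε G := by
  rcases Nat.eq_zero_or_pos s with rfl | hs
  · rw [← expect_const_mul]
    refine expect_mono_of_coin_zero fun β e hb => ?_
    simpa [hb] using mul_nonneg h0 (hG0 β e)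
  · exact (expect_coin_mul h0 h1 hs hsT hG).le

/-- The heuristic explored at time `t` is uniform and independent of the earlier ones. -/
theorem expect_explored_mul [NeZero ℓ] {t : ℕ} (ht : t ≤ T) (j : Fin ℓ)
    {G : (ℕ → Bool) → (ℕ → Fin ℓ) → ℝ}
    (hG : ∀ β e e', (∀ u < t, e u = e' u) → G β e = G β e') :
    expect T m ε (fun β e => (if j = e t then 1 else 0) * G β e) =
      (ℓ : ℝ)⁻¹ * expect T m ε G := by
  have hℓ : (ℓ : ℝ) ≠ 0 := Nat.cast_ne_zero.2 (NeZero.ne ℓ)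
  rw [expect, expect, Finset.mul_sum]
  refine Finset.sum_congr rfl fun β _ => ?_
  have key := sum_prod_weight_mul (fun (k : Fin (T + m + 1)) (_ : Fin ℓ) => (ℓ : ℝ)⁻¹)
    (Fin.ofNat (T + m + 1) t) (by simp [hℓ]) (fun i => if j = i then 1 else 0)
    (fun e => (coinProb T ε (ext β)).toReal * G (ext β) (ext e)) (fun e i => by
      congr 1
      exact hG _ _ _ fun u hu => ext_update_of_ne _ (by omega) (by omega) (by omega) _)
  simp only [Finset.prod_const, Finset.card_univ, Fintype.card_fin] at key
  simp only [mul_ite, mul_one, mul_zero, Finset.sum_ite_eq, Finset.mem_univ, if_true] at key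
  calc _ = _ := Finset.sum_congr rfl fun e _ => by
        rw [show e (Fin.ofNat (T + m + 1) t) = ext e t from rfl]; ring
    _ = _ := key
    _ = _ := by
        congr 1
        exact Finset.sum_congr rfl fun e _ => by ring

end expect

end

section

variable {ℓ : ℕ}

/-! ### The exploited heuristics -/

open Classical in
/-- The transition probabilities of the exploited heuristic. -/
def stepProb (R : (Fin ℓ → ℝ) → (Fin ℓ → ℝ) → Fin ℓ → PMF (Fin ℓ)) (x : ℕ → Fin ℓ → ℝ) (t : ℕ)
    (a b : Fin ℓ) : ℝ :=
  if x t ≠ x (t - 1) then (R (x (t - 1)) (x t) a b).toReal else if b = a then 1 else 0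

theorem sum_stepProb (R : (Fin ℓ → ℝ) → (Fin ℓ → ℝ) → Fin ℓ → PMF (Fin ℓ)) (x : ℕ → Fin ℓ → ℝ)
    (t : ℕ) (a : Fin ℓ) : ∑ b, stepProb R x t a b = 1 := by
  unfold stepProb
  split_ifs with h
  · have := PMF.tsum_coe (R (x (t - 1)) (x t) a)
    rw [tsum_fintype] at this
    rw [← ENNReal.toReal_sum fun b _ => PMF.apply_ne_top _ _, this, ENNReal.toReal_one]
  · simp

/-- The joint law of two consecutive exploited heuristics: its column sums give the new marginal,
its off-diagonal mass the switching probability. If x does not change, the plan is diagonal.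
Positivity is required because `IsRound` prescribes R only at indices of nonzero mass. -/
theorem exists_transport {R : (Fin ℓ → ℝ) → (Fin ℓ → ℝ) → Fin ℓ → PMF (Fin ℓ)} (hR : IsRound R)
    {x : ℕ → Fin ℓ → ℝ} {t : ℕ} (h0 : x (t - 1) ∈ stdSimplex ℝ (Fin ℓ))
    (h1 : x t ∈ stdSimplex ℝ (Fin ℓ)) (hpos : ∀ j, 0 < x (t - 1) j) :
    ∃ τ : Fin ℓ → Fin ℓ → ℝ, (∀ i j, x (t - 1) i * stepProb R x t i j = τ i j) ∧
      (∀ j, ∑ i, τ i j = x t j) ∧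
      ∑ i, ∑ j ∈ Finset.univ.erase i, τ i j = ∑ i, max 0 (x (t - 1) i - x t i) := by
  by_cases h : x t = x (t - 1)
  · refine ⟨fun i j => if j = i then x (t - 1) i else 0, fun i j => ?_, fun j => ?_, ?_⟩
    · simp [stepProb, h]
    · simp [h]
    · simp only [h, sub_self, max_self, Finset.sum_const_zero]
      exact Finset.sum_eq_zero fun i _ => Finset.sum_eq_zero fun j hj =>
        if_neg (Finset.ne_of_mem_erase hj)
  · obtain ⟨τ, h2, -, h3, h4, h5⟩ := hR _ h0 _ h1
    refine ⟨τ, fun i j => ?_, h3, h4⟩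
    rw [stepProb, if_pos h, h5 i (hpos i).ne' j,
      ENNReal.toReal_ofReal (div_nonneg (h2 i j) (hpos i).le), mul_div_cancel₀ _ (hpos i).ne']

theorem toReal_pathProb (R : (Fin ℓ → ℝ) → (Fin ℓ → ℝ) → Fin ℓ → PMF (Fin ℓ)) (T : ℕ)
    (x : ℕ → Fin ℓ → ℝ) (i : ℕ → Fin ℓ) :
    (pathProb R T x i).toReal =
      (ℓ : ℝ)⁻¹ * ∏ t ∈ Finset.Icc 1 T, stepProb R x t (i (t - 1)) (i t) := by
  rw [pathProb, ENNReal.toReal_mul, ENNReal.toReal_prod, ENNReal.toReal_inv, ENNReal.toReal_natCast]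
  congr 1
  refine Finset.prod_congr rfl fun t _ => ?_
  unfold stepProb
  split_ifs <;> simp

theorem pathProb_ne_top [NeZero ℓ] (R : (Fin ℓ → ℝ) → (Fin ℓ → ℝ) → Fin ℓ → PMF (Fin ℓ)) (T : ℕ)
    (x : ℕ → Fin ℓ → ℝ) (i : ℕ → Fin ℓ) : pathProb R T x i ≠ ∞ := by
  rw [pathProb]
  refine ENNReal.mul_ne_top (by simp [NeZero.ne ℓ]) (ENNReal.prod_ne_top fun t _ => ?_)
  split_ifs
  · exact PMF.apply_ne_top _ _
  · exact ENNReal.one_ne_top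
  · exact ENNReal.zero_ne_top

theorem eq_of_pathProb_ne_zero {R : (Fin ℓ → ℝ) → (Fin ℓ → ℝ) → Fin ℓ → PMF (Fin ℓ)} {T : ℕ}
    {x : ℕ → Fin ℓ → ℝ} {i : ℕ → Fin ℓ} (h : pathProb R T x i ≠ 0) {t : ℕ}
    (ht : t ∈ Finset.Icc 1 T) (hx : x t = x (t - 1)) : i t = i (t - 1) := by
  rw [pathProb] at h
  have := Finset.prod_ne_zero_iff.1 (right_ne_zero_of_mul h) t ht
  by_contra hne
  simp [hx, hne] at this

/-- Conditional expectation of a function of the exploited heuristics. -/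
def pathExpect (R : (Fin ℓ → ℝ) → (Fin ℓ → ℝ) → Fin ℓ → PMF (Fin ℓ)) (T : ℕ)
    (x : ℕ → Fin ℓ → ℝ) (h : (ℕ → Fin ℓ) → ℝ) : ℝ :=
  ∑ i : Fin (T + 1) → Fin ℓ, (pathProb R T x (ext i)).toReal * h (ext i)

/-! ### Marginals of the chain of exploited heuristics -/

section path

variable {R : (Fin ℓ → ℝ) → (Fin ℓ → ℝ) → Fin ℓ → PMF (Fin ℓ)} {T : ℕ} {x : ℕ → Fin ℓ → ℝ}

theorem pathExpect_add (h h' : (ℕ → Fin ℓ) → ℝ) :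
    pathExpect R T x (fun i => h i + h' i) = pathExpect R T x h + pathExpect R T x h' := by
  simp only [pathExpect, mul_add, Finset.sum_add_distrib]

theorem pathExpect_const_mul (a : ℝ) (h : (ℕ → Fin ℓ) → ℝ) :
    pathExpect R T x (fun i => a * h i) = a * pathExpect R T x h := by
  simp only [pathExpect, Finset.mul_sum]
  exact Finset.sum_congr rfl fun i _ => by ring

theorem pathExpect_sum {ι : Type*} (s : Finset ι) (h : ι → (ℕ → Fin ℓ) → ℝ) :
    pathExpect R T x (fun i => ∑ k ∈ s, h k i) = ∑ k ∈ s, pathExpect R T x (h k) := by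
  simp only [pathExpect, Finset.mul_sum]
  exact Finset.sum_comm

theorem ext_snoc_of_le {α : Type*} {n : ℕ} (u : Fin (n + 1) → α) (a : α) {t : ℕ} (ht : t ≤ n) :
    ext (Fin.snoc u a : Fin (n + 1 + 1) → α) t = ext u t := by
  have h1 : Fin.ofNat (n + 1 + 1) t = (Fin.ofNat (n + 1) t).castSucc := by
    apply Fin.ext
    simp [Nat.mod_eq_of_lt (show t < n + 1 by omega), Nat.mod_eq_of_lt (show t < n + 1 + 1 by omega)]
  rw [ext, ext, h1, Fin.snoc_castSucc]

theorem ext_snoc_last {α : Type*} {n : ℕ} (u : Fin (n + 1) → α) (a : α) :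
    ext (Fin.snoc u a : Fin (n + 1 + 1) → α) (n + 1) = a := by
  have h1 : Fin.ofNat (n + 1 + 1) (n + 1) = Fin.last (n + 1) := by
    apply Fin.ext
    simp
  rw [ext, h1, Fin.snoc_last]

theorem sum_snoc {α : Type*} [Fintype α] {n : ℕ} (F : (Fin (n + 1) → α) → ℝ) :
    ∑ u, F u = ∑ u : Fin n → α, ∑ a, F (Fin.snoc u a) := by
  rw [← Equiv.sum_comp (Fin.snocEquiv fun _ => α), Fintype.sum_prod_type, Finset.sum_comm]
  rfl

/-- Conditioning on all but the last step of the chain. -/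
theorem pathExpect_succ {h : (ℕ → Fin ℓ) → ℝ}
    (hh : ∀ u v, (∀ s ≤ T + 1, u s = v s) → h u = h v) :
    pathExpect R (T + 1) x h = pathExpect R T x fun i =>
      ∑ b, stepProb R x (T + 1) (i T) b * h (Function.update i (T + 1) b) := by
  rw [pathExpect, sum_snoc, pathExpect]
  refine Finset.sum_congr rfl fun u _ => ?_
  rw [Finset.mul_sum]
  refine Finset.sum_congr rfl fun b _ => ?_
  rw [toReal_pathProb, toReal_pathProb, Finset.prod_Icc_succ_top (by omega), Nat.add_sub_cancel,
    ext_snoc_last, ext_snoc_of_le _ _ le_rfl, ← mul_assoc, ← mul_assoc]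
  congr 1
  · congr 2
    refine Finset.prod_congr rfl fun t ht => ?_
    rw [Finset.mem_Icc] at ht
    rw [ext_snoc_of_le _ _ ht.2, ext_snoc_of_le _ _ (by omega)]
  · refine hh _ _ fun s hs => ?_
    rcases Nat.lt_or_ge T s with h1 | h1
    · obtain rfl : s = T + 1 := by omega
      rw [ext_snoc_last, Function.update_self]
    · rw [ext_snoc_of_le _ _ h1, Function.update_of_ne (by omega)]

/-- The transition probabilities from each index sum to one, so later steps integrate out. -/
theorem pathExpect_of_le {h : (ℕ → Fin ℓ) → ℝ} {t : ℕ} (ht : t ≤ T)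
    (hh : ∀ u v, (∀ s ≤ t, u s = v s) → h u = h v) :
    pathExpect R T x h = pathExpect R t x h := by
  induction T, ht using Nat.le_induction with
  | base => rfl
  | succ T hT ih =>
    rw [pathExpect_succ fun u v huv => hh u v fun s hs => huv s (by omega), ← ih]
    congr 1
    ext i
    have : ∀ b, h (Function.update i (T + 1) b) = h i := fun b =>
      hh _ _ fun s hs => Function.update_of_ne (by omega) _ _
    simp only [this, ← Finset.sum_mul, sum_stepProb, one_mul]

variable (hR : IsRound R) (hx : ∀ t, x t ∈ stdSimplex ℝ (Fin ℓ)) (hpos : ∀ t j, 0 < x t j)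
  (hx0 : ∀ j, x 0 j = (ℓ : ℝ)⁻¹)

include hR hx hpos hx0

theorem pathExpect_last (φ : Fin ℓ → ℝ) (t : ℕ) :
    pathExpect R t x (fun i => φ (i t)) = ∑ j, x t j * φ j := by
  induction t generalizing φ with
  | zero =>
    rw [pathExpect, ← Equiv.sum_comp (Equiv.funUnique (Fin 1) (Fin ℓ)).symm]
    refine Finset.sum_congr rfl fun j _ => ?_
    rw [toReal_pathProb, hx0]
    simp [ext]
  | succ t ih =>
    rw [pathExpect_succ fun u v huv => by rw [huv _ le_rfl]]
    simp only [Function.update_self]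
    rw [ih fun a => ∑ b, stepProb R x (t + 1) a b * φ b]
    obtain ⟨τ, h1, h2, -⟩ := exists_transport (t := t + 1) hR (hx _) (hx _) (hpos _)
    simp only [Nat.add_sub_cancel] at h1
    simp only [Finset.mul_sum, ← mul_assoc, h1]
    rw [Finset.sum_comm]
    exact Finset.sum_congr rfl fun b _ => by rw [← Finset.sum_mul, h2]

/-- The exploited heuristic at time `t` has the distribution `x t`. -/
theorem pathExpect_apply (φ : Fin ℓ → ℝ) {t : ℕ} (ht : t ≤ T) :
    pathExpect R T x (fun i => φ (i t)) = ∑ j, x t j * φ j := by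
  rw [pathExpect_of_le ht fun u v huv => by rw [huv _ le_rfl],
    pathExpect_last hR hx hpos hx0]

/-- The probability of a switch at time `t + 1`. -/
theorem pathExpect_switch {t : ℕ} (ht : t + 1 ≤ T) :
    pathExpect R T x (fun i => if i (t + 1) ≠ i t then 1 else 0) =
      ∑ j, max 0 (x t j - x (t + 1) j) := by
  rw [pathExpect_of_le ht fun u v huv => by rw [huv _ le_rfl, huv t (by omega)],
    pathExpect_succ fun u v huv => by rw [huv _ le_rfl, huv t (by omega)]]
  simp only [Function.update_self, Function.update_of_ne (show t ≠ t + 1 by omega)]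
  rw [pathExpect_last hR hx hpos hx0
    fun a => ∑ b, stepProb R x (t + 1) a b * (if b ≠ a then 1 else 0)]
  obtain ⟨τ, h1, -, h3⟩ := exists_transport (t := t + 1) hR (hx _) (hx _) (hpos _)
  simp only [Nat.add_sub_cancel] at h1 h3
  rw [← h3]
  refine Finset.sum_congr rfl fun a _ => ?_
  simp only [Finset.mul_sum, h1, mul_ite, mul_one, mul_zero]
  rw [← Finset.sum_filter, Finset.filter_ne']

end path

end

section

variable {ℓ : ℕ}

/-! ### The learner as a function of the coins and the explored heuristics -/

/-- The loss vector at time `t` in terms of the costs `f` of the heuristics. -/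
def explorationLoss (D : ℝ) (f : ℕ → Fin ℓ → ℝ) (m : ℕ) (β : ℕ → Bool) (e : ℕ → Fin ℓ) (t : ℕ)
    (j : Fin ℓ) : ℝ :=
  if timer m β t = 1 ∧ j = e t then f t j / (2 * D) else 0

/-- The distribution of HEDGE at time `t` for the losses `explorationLoss`. -/
def learned (D η : ℝ) (f : ℕ → Fin ℓ → ℝ) (m : ℕ) (β : ℕ → Bool) (e : ℕ → Fin ℓ) (t : ℕ) :
    Fin ℓ → ℝ :=
  hedge η (explorationLoss D f m β e) t

/-- The mean cost at time `t` for the distribution of time `s`. -/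
def meanCost (D η : ℝ) (f : ℕ → Fin ℓ → ℝ) (m : ℕ) (s t : ℕ) (β : ℕ → Bool) (e : ℕ → Fin ℓ) : ℝ :=
  ∑ j, learned D η f m β e s j * f t j

/-- The mean loss of HEDGE at time `t`. -/
def meanLoss (D η : ℝ) (f : ℕ → Fin ℓ → ℝ) (m : ℕ) (t : ℕ) (β : ℕ → Bool) (e : ℕ → Fin ℓ) : ℝ :=
  ∑ j, learned D η f m β e t j * explorationLoss D f m β e t j

/-- The mass moved by HEDGE from time `t - 1` to time `t`. -/
def movedMass (D η : ℝ) (f : ℕ → Fin ℓ → ℝ) (m : ℕ) (t : ℕ) (β : ℕ → Bool) (e : ℕ → Fin ℓ) : ℝ :=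
  ∑ j, max 0 (learned D η f m β e (t - 1) j - learned D η f m β e t j)

/-- The mean cost at time `t`, including the movement due to a switch. -/
def meanStep (D η : ℝ) (f : ℕ → Fin ℓ → ℝ) (m t : ℕ) (β : ℕ → Bool) (e : ℕ → Fin ℓ) : ℝ :=
  meanCost D η f m t t β e + D * movedMass D η f m t β e

section learner

variable {D η : ℝ} {f : ℕ → Fin ℓ → ℝ} {m : ℕ}

theorem explorationLoss_congr {β β' : ℕ → Bool} {e e' : ℕ → Fin ℓ} {t : ℕ}
    (hβ : ∀ u < t, β u = β' u) (he : e t = e' t) :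
    explorationLoss D f m β e t = explorationLoss D f m β' e' t := by
  ext j
  rw [explorationLoss, explorationLoss, timer_congr hβ, he]

theorem learned_congr {β β' : ℕ → Bool} {e e' : ℕ → Fin ℓ} {t : ℕ}
    (hβ : ∀ u < t, β u = β' u) (he : ∀ u < t, e u = e' u) :
    learned D η f m β e t = learned D η f m β' e' t :=
  hedge_congr fun u hu => explorationLoss_congr (fun v hv => hβ v (hv.trans hu)) (he u hu)

theorem meanCost_congr {β β' : ℕ → Bool} {e e' : ℕ → Fin ℓ} {s t : ℕ}
    (hβ : ∀ u < s, β u = β' u) (he : ∀ u < s, e u = e' u) :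
    meanCost D η f m s t β e = meanCost D η f m s t β' e' := by
  rw [meanCost, meanCost, learned_congr hβ he]

theorem movedMass_congr {β β' : ℕ → Bool} {e e' : ℕ → Fin ℓ} {t : ℕ}
    (hβ : ∀ u < t, β u = β' u) (he : ∀ u < t, e u = e' u) :
    movedMass D η f m t β e = movedMass D η f m t β' e' := by
  rw [movedMass, movedMass, learned_congr hβ he,
    learned_congr (t := t - 1) (fun u hu => hβ u (by omega)) fun u hu => he u (by omega)]

theorem movedMass_nonneg (t : ℕ) (β : ℕ → Bool) (e : ℕ → Fin ℓ) :
    0 ≤ movedMass D η f m t β e :=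
  Finset.sum_nonneg fun _ _ => le_max_left _ _

theorem movedMass_zero (β : ℕ → Bool) (e : ℕ → Fin ℓ) : movedMass D η f m 0 β e = 0 := by
  simp [movedMass]

theorem explorationLoss_eq_zero {β : ℕ → Bool} {e : ℕ → Fin ℓ} {t : ℕ} (h : timer m β t ≠ 1)
    (j : Fin ℓ) : explorationLoss D f m β e t j = 0 :=
  if_neg fun h' => h h'.1

theorem learned_succ_of_timer_ne_one {β : ℕ → Bool} {e : ℕ → Fin ℓ} {t : ℕ}
    (h : timer m β t ≠ 1) : learned D η f m β e (t + 1) = learned D η f m β e t :=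
  hedge_succ_of_eq_zero fun j => explorationLoss_eq_zero h j

theorem explorationLoss_nonneg (hD : 0 < D) (hf0 : ∀ t j, 0 ≤ f t j)
    (β : ℕ → Bool) (e : ℕ → Fin ℓ) (t : ℕ) (j : Fin ℓ) :
    0 ≤ explorationLoss D f m β e t j := by
  rw [explorationLoss]
  split_ifs
  · exact div_nonneg (hf0 t j) (by linarith)
  · exact le_rfl

theorem explorationLoss_le_one (hD : 0 < D) (hf1 : ∀ t j, f t j ≤ 2 * D)
    (β : ℕ → Bool) (e : ℕ → Fin ℓ) (t : ℕ) (j : Fin ℓ) :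
    explorationLoss D f m β e t j ≤ 1 := by
  rw [explorationLoss]
  split_ifs
  · exact (div_le_one (by linarith)).2 (hf1 t j)
  · exact zero_le_one

variable [NeZero ℓ] (hD : 0 < D) (hf0 : ∀ t j, 0 ≤ f t j) (hf1 : ∀ t j, f t j ≤ 2 * D)

theorem learned_pos (β : ℕ → Bool) (e : ℕ → Fin ℓ) (t : ℕ) (j : Fin ℓ) :
    0 < learned D η f m β e t j :=
  hedge_pos _ _ _ _

theorem sum_learned (β : ℕ → Bool) (e : ℕ → Fin ℓ) (t : ℕ) :
    ∑ j, learned D η f m β e t j = 1 :=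
  sum_hedge _ _ _

theorem movedMass_le_one (t : ℕ) (β : ℕ → Bool) (e : ℕ → Fin ℓ) :
    movedMass D η f m t β e ≤ 1 := by
  rw [← sum_learned (D := D) (η := η) (f := f) (m := m) β e (t - 1)]
  refine Finset.sum_le_sum fun j _ => max_le (learned_pos _ _ _ _).le ?_
  linarith [learned_pos (D := D) (η := η) (f := f) (m := m) β e t j]

include hf0

theorem meanCost_nonneg (s t : ℕ) (β : ℕ → Bool) (e : ℕ → Fin ℓ) :
    0 ≤ meanCost D η f m s t β e :=
  Finset.sum_nonneg fun j _ => mul_nonneg (learned_pos β e s j).le (hf0 t j)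

include hD

theorem meanLoss_nonneg (t : ℕ) (β : ℕ → Bool) (e : ℕ → Fin ℓ) :
    0 ≤ meanLoss D η f m t β e :=
  Finset.sum_nonneg fun j _ =>
    mul_nonneg (learned_pos β e t j).le (explorationLoss_nonneg hD hf0 β e t j)

theorem movedMass_succ_le (hη : 0 ≤ η) (t : ℕ) (β : ℕ → Bool) (e : ℕ → Fin ℓ) :
    movedMass D η f m (t + 1) β e ≤ η * meanLoss D η f m t β e :=
  sum_max_hedge_sub_le hη fun j => explorationLoss_nonneg hD hf0 β e t j

include hf1

omit hD hf0 in
theorem meanCost_le (s t : ℕ) (β : ℕ → Bool) (e : ℕ → Fin ℓ) :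
    meanCost D η f m s t β e ≤ 2 * D := by
  calc _ ≤ ∑ j, learned D η f m β e s j * (2 * D) :=
        Finset.sum_le_sum fun j _ => mul_le_mul_of_nonneg_left (hf1 t j) (learned_pos β e s j).le
    _ = 2 * D := by rw [← Finset.sum_mul, sum_learned, one_mul]

/-- Within `m + 1` steps, the distribution changes by a factor `exp η` at most. -/
theorem learned_stable_aux (hη : 0 ≤ η) (β : ℕ → Bool) (e : ℕ → Fin ℓ) {s t : ℕ} (hst : s ≤ t)
    (j : Fin ℓ) :
    Real.exp (-η) ^ ((Finset.Ico s t).filter fun u => timer m β u = 1).card *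
        learned D η f m β e s j ≤ learned D η f m β e t j ∧
      Real.exp (-η) ^ ((Finset.Ico s t).filter fun u => timer m β u = 1).card *
        learned D η f m β e t j ≤ learned D η f m β e s j := by
  induction t, hst using Nat.le_induction with
  | base => simp
  | succ t hst ih =>
    rw [← Finset.insert_Ico_right_eq_Ico_add_one hst, Finset.filter_insert]
    by_cases h : timer m β t = 1
    · rw [if_pos h, Finset.card_insert_of_notMem (by simp), pow_succ]
      have h1 : Real.exp (-η) * learned D η f m β e t j ≤ learned D η f m β e (t + 1) j :=
        exp_neg_mul_hedge_le_succ hη (explorationLoss_nonneg hD hf0 β e t)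
          (explorationLoss_le_one hD hf1 β e t) j
      have h2 : Real.exp (-η) * learned D η f m β e (t + 1) j ≤ learned D η f m β e t j :=
        exp_neg_mul_hedge_succ_le hη (explorationLoss_nonneg hD hf0 β e t)
          (explorationLoss_le_one hD hf1 β e t) j
      set p := Real.exp (-η) ^ ((Finset.Ico s t).filter fun u => timer m β u = 1).card
      have hp : 0 ≤ p := by positivity
      have he := (Real.exp_pos (-η)).le
      constructor
      · refine le_trans ?_ h1
        rw [mul_comm p, mul_assoc]
        exact mul_le_mul_of_nonneg_left ih.1 he
      · refine le_trans ?_ ih.2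
        rw [mul_assoc]
        exact mul_le_mul_of_nonneg_left h2 hp
    · rw [if_neg h, learned_succ_of_timer_ne_one h]
      exact ih

theorem learned_stable (hη : 0 ≤ η) (β : ℕ → Bool) (e : ℕ → Fin ℓ) {s t : ℕ}
    (hst : s ≤ t + m + 1) (hts : t ≤ s + m + 1) (j : Fin ℓ) :
    Real.exp (-η) * learned D η f m β e s j ≤ learned D η f m β e t j := by
  have key : ∀ {u v : ℕ}, v ≤ u + m + 1 → ∀ {y : ℝ}, 0 ≤ y → Real.exp (-η) * y ≤
      Real.exp (-η) ^ ((Finset.Ico u v).filter fun u => timer m β u = 1).card * y := by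
    intro u v h y hy
    refine mul_le_mul_of_nonneg_right ?_ hy
    calc Real.exp (-η) = Real.exp (-η) ^ 1 := (pow_one _).symm
      _ ≤ _ := pow_le_pow_of_le_one (Real.exp_pos _).le (Real.exp_le_one_iff.2 (by linarith))
        (card_exploration_le_one h)
  rcases le_total s t with h | h
  · exact (key hts (learned_pos β e s j).le).trans
      (learned_stable_aux hD hf0 hf1 hη β e h j).1
  · exact (key hst (learned_pos β e s j).le).trans
      (learned_stable_aux hD hf0 hf1 hη β e h j).2

theorem meanCost_stable (hη : 0 ≤ η) (β : ℕ → Bool) (e : ℕ → Fin ℓ) {s s' : ℕ} (t : ℕ)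
    (h : s ≤ s' + m + 1) (h' : s' ≤ s + m + 1) :
    Real.exp (-η) * meanCost D η f m s t β e ≤ meanCost D η f m s' t β e := by
  rw [meanCost, Finset.mul_sum]
  refine Finset.sum_le_sum fun j _ => ?_
  rw [← mul_assoc]
  exact mul_le_mul_of_nonneg_right (learned_stable hD hf0 hf1 hη β e h h' j) (hf0 t j)

theorem meanCost_stable_two (hη : 0 ≤ η) (β : ℕ → Bool) (e : ℕ → Fin ℓ) {s s' : ℕ} (t : ℕ)
    (h : s ≤ s' + 2 * m) (h' : s' ≤ s + 2 * m) :
    Real.exp (-η) ^ 2 * meanCost D η f m s t β e ≤ meanCost D η f m s' t β e := by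
  have he := (Real.exp_pos (-η)).le
  rw [pow_two, mul_assoc]
  -- An intermediate time splits the distance 2m into two hops of length at most m.
  refine le_trans (mul_le_mul_of_nonneg_left (meanCost_stable hD hf0 hf1 hη β e (s := s)
    (s' := if s ≤ s' then min (s + m) s' else min (s' + m) s) t ?_ ?_) he)
    (meanCost_stable hD hf0 hf1 hη β e t ?_ ?_)
  all_goals split_ifs <;> omega

end learner

/-! ### Sums over shifted and sliding windows -/

theorem sum_sub_le_sum {a : ℕ → ℝ} (h0 : a 0 = 0) (ha : ∀ t, 0 ≤ a t) (k n : ℕ) :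
    ∑ t ∈ Finset.range n, a (t - k) ≤ ∑ t ∈ Finset.range n, a t := by
  have h1 : ∑ t ∈ Finset.range n, a (t - k) = ∑ t ∈ Finset.range (n - k), a t := by
    induction n with
    | zero => simp
    | succ n ih =>
      rw [Finset.sum_range_succ, ih]
      rcases Nat.lt_or_ge n k with h | h
      · rw [show n - k = 0 by omega, show n + 1 - k = 0 by omega, h0, add_zero]
      · rw [show n + 1 - k = n - k + 1 by omega, Finset.sum_range_succ]
  rw [h1]
  exact Finset.sum_le_sum_of_subset_of_nonneg (Finset.range_mono (Nat.sub_le n k))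
    fun t _ _ => ha t

/-- Each u belongs to at most k of the windows. -/
theorem sum_sum_Ioc_le {a : ℕ → ℝ} (ha : ∀ t, 0 ≤ a t) (k n : ℕ) :
    ∑ t ∈ Finset.range n, ∑ u ∈ Finset.Ioc (t - k) t, a u ≤ k * ∑ t ∈ Finset.range n, a t := by
  rw [Finset.sum_comm' (t' := Finset.range n)
    (s' := fun u => (Finset.range n).filter fun t => u ∈ Finset.Ioc (t - k) t) (fun t u => by
      simp only [Finset.mem_range, Finset.mem_Ioc, Finset.mem_filter]
      omega), Finset.mul_sum]
  refine Finset.sum_le_sum fun u _ => ?_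
  rw [Finset.sum_const, nsmul_eq_mul]
  refine mul_le_mul_of_nonneg_right ?_ (ha u)
  have : ((Finset.range n).filter fun t => u ∈ Finset.Ioc (t - k) t).card ≤
      (Finset.Ico u (u + k)).card := Finset.card_le_card fun t ht => by
    simp only [Finset.mem_range, Finset.mem_Ioc, Finset.mem_filter] at ht
    exact Finset.mem_Ico.2 (by omega)
  rw [Nat.card_Ico, Nat.add_sub_cancel_left] at this
  exact_mod_cast this

/-! ### Expected costs -/

section expected

variable [NeZero ℓ] {D η ε γ : ℝ} {f : ℕ → Fin ℓ → ℝ} {m T : ℕ}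
  (hD : 0 < D) (hf0 : ∀ t j, 0 ≤ f t j) (hf1 : ∀ t j, f t j ≤ 2 * D)
  (hη : Real.exp (-η) = 1 - γ) (hγ0 : 0 ≤ γ) (hγ1 : γ ≤ 1 / 100)
  (hε0 : 0 ≤ ε) (hε1 : ε ≤ 1)

theorem nonneg_of_exp_neg {η γ : ℝ} (hη : Real.exp (-η) = 1 - γ) (hγ0 : 0 ≤ γ) : 0 ≤ η := by
  have : Real.exp (-η) ≤ 1 := by linarith
  have := Real.exp_le_one_iff.1 this
  linarith

include hD hf0 hf1 hη hγ0 hγ1 hε0 hε1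

/-- Decoupling: the distribution at t' may depend on the coin u, but the one at s ≤ u does not.
Moving from t' to s and then from s to t costs exp(-η) four times, and (1 - γ)^4 ≥ 24/25 leaves room
for the factor 11/10. -/
theorem expect_coin_mul_meanCost_le {s u t' t : ℕ} (huT : u ≤ T) (hsu : s ≤ u)
    (h1 : t' ≤ s + 2 * m) (h2 : s ≤ t' + 2 * m) (h3 : t ≤ s + 2 * m) (h4 : s ≤ t + 2 * m) :
    expect T m ε (fun β e => (if β u then 1 else 0) * meanCost D η f m t' t β e) ≤
      11 / 10 * ε * expect T m ε (meanCost D η f m t t) := by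
  have hη0 := nonneg_of_exp_neg hη hγ0
  have hA : expect T m ε (fun β e => (if β u then 1 else 0) *
      (Real.exp (-η) ^ 2 * meanCost D η f m t' t β e)) ≤
      ε * expect T m ε (meanCost D η f m s t) := by
    refine le_trans (expect_mono fun β e => ?_) (expect_coin_mul_le hε0 hε1 huT
      (fun β e => meanCost_nonneg hf0 s t β e) fun β β' e h =>
        meanCost_congr (fun v hv => h v (by omega)) fun _ _ => rfl)
    exact mul_le_mul_of_nonneg_left (meanCost_stable_two hD hf0 hf1 hη0 β e t h1 h2)
      (by split_ifs <;> norm_num)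
  have hB : Real.exp (-η) ^ 2 * expect T m ε (meanCost D η f m s t) ≤
      expect T m ε (meanCost D η f m t t) := by
    rw [← expect_const_mul]
    exact expect_mono fun β e => meanCost_stable_two hD hf0 hf1 hη0 β e t h4 h3
  simp only [mul_left_comm _ (Real.exp (-η) ^ 2)] at hA
  rw [expect_const_mul, hη] at hA
  rw [hη] at hB
  set P := expect T m ε (fun β e => (if β u then 1 else 0) * meanCost D η f m t' t β e)
  set Q := expect T m ε (meanCost D η f m s t)
  set Y := expect T m ε (meanCost D η f m t t) with hY
  have hY0 : 0 ≤ Y := expect_nonneg fun β e => meanCost_nonneg hf0 t t β e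
  have hρ : (24 / 25 : ℝ) ≤ (1 - γ) ^ 2 * (1 - γ) ^ 2 := by
    have : (49 / 50 : ℝ) ≤ (1 - γ) ^ 2 := by nlinarith
    nlinarith
  have hP : (1 - γ) ^ 2 * (1 - γ) ^ 2 * P ≤ ε * Y := by
    calc _ = (1 - γ) ^ 2 * ((1 - γ) ^ 2 * P) := by ring
      _ ≤ (1 - γ) ^ 2 * (ε * Q) := mul_le_mul_of_nonneg_left hA (sq_nonneg _)
      _ = ε * ((1 - γ) ^ 2 * Q) := by ring
      _ ≤ _ := mul_le_mul_of_nonneg_left hB hε0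
  have hεY := mul_nonneg hε0 hY0
  by_contra hcon
  push Not at hcon
  have hP0 : 0 ≤ P := by nlinarith
  nlinarith

/-- The mean cost in exploration steps. -/
theorem expect_exploration_meanCost_ge (hm : 1 ≤ m) (hmε : m * ε ≤ γ) {t : ℕ} (htm : m < t)
    (htT : t ≤ T) :
    ε * (1 - 4 * γ) * expect T m ε (meanCost D η f m t t) ≤
      expect T m ε (fun β e => (if timer m β t = 1 then 1 else 0) * meanCost D η f m t t β e) := by
  have hη0 := nonneg_of_exp_neg hη hγ0
  obtain ⟨s, rfl⟩ := Nat.exists_eq_add_of_lt htm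
  rw [show m + s + 1 = s + 1 + m by omega] at *
  -- The coin of the exploration step r + m is thrown at time r. Here r ≥ 1, so it is a genuine
  -- Bernoulli coin.
  set r := s + 1 with hr
  -- Passing from the distribution at r + m to the one at r makes everything but the coin at r
  -- depend on earlier coins only.
  have h1 : ∀ β e, Real.exp (-η) * ((if β r then 1 else 0) *
      ((if timer m β r = 0 then 1 else 0) * meanCost D η f m r (r + m) β e)) ≤
      (if timer m β (r + m) = 1 then 1 else 0) * meanCost D η f m (r + m) (r + m) β e := by
    intro β e
    by_cases hb : timer m β r = 0 ∧ β r = true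
    · rw [if_pos hb.2, if_pos hb.1, if_pos ((timer_eq_one_iff hm).2 hb), one_mul, one_mul, one_mul]
      exact meanCost_stable hD hf0 hf1 hη0 β e _ (by omega) (by omega)
    · rw [if_neg fun h => hb ((timer_eq_one_iff hm).1 h), zero_mul]
      by_cases hb' : timer m β r = 0
      · rw [if_neg fun h => hb ⟨hb', h⟩]; simp
      · rw [if_neg hb']; simp
  have h2 : expect T m ε (fun β e => (if β r then 1 else 0) *
      ((if timer m β r = 0 then 1 else 0) * meanCost D η f m r (r + m) β e)) =
      ε * expect T m ε (fun β e =>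
        (if timer m β r = 0 then 1 else 0) * meanCost D η f m r (r + m) β e) :=
    expect_coin_mul hε0 hε1 (by omega) (by omega) fun β β' e h => by
      rw [timer_congr h, meanCost_congr h fun _ _ => rfl]
  -- Time r can lie inside a block only if one of the m preceding coins succeeded: a union bound.
  have h3 : ∀ β e, meanCost D η f m r (r + m) β e - ∑ u ∈ Finset.Ico (r - m) r,
      (if β u then 1 else 0) * meanCost D η f m r (r + m) β e ≤
      (if timer m β r = 0 then 1 else 0) * meanCost D η f m r (r + m) β e := by
    intro β e
    have h0 := meanCost_nonneg (D := D) (η := η) (m := m) hf0 r (r + m) β e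
    have hnn : ∀ u ∈ Finset.Ico (r - m) r,
        (0 : ℝ) ≤ (if β u then 1 else 0) * meanCost D η f m r (r + m) β e :=
      fun u _ => mul_nonneg (by split_ifs <;> norm_num) h0
    by_cases hb : timer m β r = 0
    · rw [if_pos hb, one_mul]
      linarith [Finset.sum_nonneg hnn]
    · rw [if_neg hb, zero_mul]
      obtain ⟨u, hu, hβ⟩ := exists_coin_of_timer_ne_zero hb
      have := Finset.single_le_sum hnn hu
      rw [if_pos hβ, one_mul] at this
      linarith
  set Y := expect T m ε (meanCost D η f m (r + m) (r + m)) with hY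
  have hY0 : 0 ≤ Y := expect_nonneg fun β e => meanCost_nonneg hf0 _ _ β e
  have h4 : expect T m ε (meanCost D η f m r (r + m)) - m * (11 / 10 * ε * Y) ≤
      expect T m ε (fun β e =>
        (if timer m β r = 0 then 1 else 0) * meanCost D η f m r (r + m) β e) := by
    refine le_trans ?_ (expect_mono h3)
    rw [expect_sub, expect_sum]
    refine sub_le_sub_left ?_ _
    calc _ ≤ ∑ u ∈ Finset.Ico (r - m) r, 11 / 10 * ε * Y := by
          refine Finset.sum_le_sum fun u hu => ?_
          rw [Finset.mem_Ico] at hu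
          exact expect_coin_mul_meanCost_le hD hf0 hf1 hη hγ0 hγ1 hε0 hε1 (s := u) (by omega)
            le_rfl (by omega) (by omega) (by omega) (by omega)
      _ ≤ _ := by
          rw [Finset.sum_const, Nat.card_Ico, nsmul_eq_mul]
          refine mul_le_mul_of_nonneg_right ?_ (by positivity)
          exact_mod_cast (by omega : r - (r - m) ≤ m)
  have h5 : Real.exp (-η) * Y ≤ expect T m ε (meanCost D η f m r (r + m)) := by
    rw [hY, ← expect_const_mul]
    exact expect_mono fun β e => meanCost_stable hD hf0 hf1 hη0 β e _ (by omega) (by omega)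
  refine le_trans ?_ (expect_mono h1)
  rw [expect_const_mul, h2, hη]
  rw [hη] at h5
  have h6 : (1 - γ) * Y - 11 / 10 * γ * Y ≤ expect T m ε (fun β e =>
      (if timer m β r = 0 then 1 else 0) * meanCost D η f m r (r + m) β e) := by
    refine le_trans ?_ h4
    have : m * ε * Y ≤ γ * Y := mul_le_mul_of_nonneg_right hmε hY0
    linarith
  have hγ' : 0 ≤ 1 - γ := by linarith
  calc ε * (1 - 4 * γ) * Y ≤ (1 - γ) * (ε * ((1 - γ) * Y - 11 / 10 * γ * Y)) := by
        have : 0 ≤ ε * Y := mul_nonneg hε0 hY0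
        have h7 : 1 - 4 * γ ≤ (1 - γ) * (1 - γ - 11 / 10 * γ) := by nlinarith
        have := mul_le_mul_of_nonneg_left h7 this
        linarith
    _ ≤ _ := mul_le_mul_of_nonneg_left (mul_le_mul_of_nonneg_left h6 hε0) hγ'

omit hf1 hη hγ0 hγ1 hε0 hε1 hD hf0 in
-- The explored heuristic at time t is uniform and independent of the timer and of the distribution
-- at t, which sees only earlier explored heuristics.
theorem expect_meanLoss {t : ℕ} (ht : t ≤ T) :
    expect T m ε (meanLoss D η f m t) = (2 * D)⁻¹ * ((ℓ : ℝ)⁻¹ *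
      expect T m ε
        (fun β e => (if timer m β t = 1 then 1 else 0) * meanCost D η f m t t β e)) := by
  have h1 : meanLoss D η f m t = fun β e => ∑ j, (if j = e t then 1 else 0) *
      ((2 * D)⁻¹ * ((if timer m β t = 1 then 1 else 0) * (learned D η f m β e t j * f t j))) := by
    ext β e
    refine Finset.sum_congr rfl fun j _ => ?_
    rw [explorationLoss]
    by_cases h : timer m β t = 1 <;> by_cases h' : j = e t <;> simp [h, h']
    ring
  rw [h1, expect_sum]
  have h2 : ∀ j : Fin ℓ, expect T m ε (fun β e => (if j = e t then 1 else 0) *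
      ((2 * D)⁻¹ * ((if timer m β t = 1 then 1 else 0) * (learned D η f m β e t j * f t j)))) =
      (ℓ : ℝ)⁻¹ * expect T m ε (fun β e =>
      ((2 * D)⁻¹ * ((if timer m β t = 1 then 1 else 0) * (learned D η f m β e t j * f t j)))) :=
    fun j => expect_explored_mul ht j fun β e e' h => by
      rw [learned_congr (fun _ _ => rfl) h]
  simp only [h2, expect_const_mul]
  rw [← Finset.mul_sum, ← Finset.mul_sum, ← expect_sum]
  simp only [meanCost, Finset.mul_sum]
  ring_nf

omit hf1 hη hγ0 hγ1 in
-- For a fixed heuristic an upper bound suffices: exploring at time t forces the coin at t - m to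
-- succeed, whatever the timers were.
theorem expect_explorationLoss_le {t : ℕ} (ht : t ≤ T) (i : Fin ℓ) :
    expect T m ε (fun β e => explorationLoss D f m β e t i) ≤
      (2 * D)⁻¹ * ((ℓ : ℝ)⁻¹ * (ε * f t i)) := by
  have h1 : (fun β e => explorationLoss D f m β e t i) = fun β e => (if i = e t then 1 else 0) *
      ((2 * D)⁻¹ * f t i * (if timer m β t = 1 then 1 else 0)) := by
    ext β e
    rw [explorationLoss]
    by_cases h : timer m β t = 1 <;> by_cases h' : i = e t <;> simp [h, h']
    ring
  rw [h1, expect_explored_mul ht i fun β e e' h => rfl, expect_const_mul]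
  have h2 : expect T m ε (fun β (_ : ℕ → Fin ℓ) => if timer m β t = 1 then 1 else 0) ≤ ε := by
    have h3 : expect T m ε (fun β (_ : ℕ → Fin ℓ) => (if β (t - m) then 1 else 0) * 1) ≤ ε := by
      have := expect_coin_mul_le (ℓ := ℓ) (m := m) hε0 hε1 (s := t - m) (T := T) (by omega)
        (G := fun _ _ => 1) (fun _ _ => zero_le_one) fun _ _ _ _ => rfl
      rwa [expect_const hε0 hε1, mul_one] at this
    refine le_trans (expect_mono fun β e => ?_) h3
    by_cases h : timer m β t = 1
    · obtain ⟨s, -, h4, -, h5⟩ := exists_start_of_timer_ne_zero (by rw [h]; exact one_ne_zero)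
      rw [h] at h4
      rw [show t - m = s by omega, if_pos h, if_pos h5, one_mul]
    · rw [if_neg h]
      split_ifs <;> norm_num
  have h3 : 0 ≤ (2 * D)⁻¹ * f t i * (ℓ : ℝ)⁻¹ := by
    have := hf0 t i
    positivity
  calc _ = (2 * D)⁻¹ * f t i * (ℓ : ℝ)⁻¹ *
        expect T m ε (fun β (_ : ℕ → Fin ℓ) => if timer m β t = 1 then 1 else 0) := by ring
    _ ≤ (2 * D)⁻¹ * f t i * (ℓ : ℝ)⁻¹ * ε := mul_le_mul_of_nonneg_left h2 h3
    _ = _ := by ring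

omit hγ1 in
/-- The expected total loss of HEDGE. -/
theorem sum_expect_meanLoss_le (i : Fin ℓ) :
    γ * ∑ t ∈ Finset.range (T + 1), expect T m ε (meanLoss D η f m t) ≤
      η * ((2 * D)⁻¹ * ((ℓ : ℝ)⁻¹ * (ε * ∑ t ∈ Finset.range (T + 1), f t i))) + Real.log ℓ := by
  have h1 : ∀ β e, γ * ∑ t ∈ Finset.range (T + 1), meanLoss D η f m t β e ≤
      η * (∑ t ∈ Finset.range (T + 1), explorationLoss D f m β e t i) + Real.log ℓ := by
    intro β e
    have := hedge_regret (η := η) (explorationLoss_nonneg (m := m) hD hf0 β e)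
      (explorationLoss_le_one hD hf1 β e) (T + 1) i
    rwa [hη, sub_sub_cancel] at this
  have h2 := expect_mono (T := T) (m := m) (ε := ε) h1
  rw [expect_const_mul, expect_sum, expect_add, expect_const_mul, expect_sum,
    expect_const hε0 hε1] at h2
  refine h2.trans (add_le_add_left (mul_le_mul_of_nonneg_left ?_ (nonneg_of_exp_neg hη hγ0)) _)
  simp only [Finset.mul_sum]
  exact Finset.sum_le_sum fun t ht => expect_explorationLoss_le hD hf0 hε0 hε1
    (Nat.lt_succ_iff.1 (Finset.mem_range.1 ht)) i

/-- The expected mean cost is bounded by the expected loss of HEDGE. -/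
theorem sum_expect_meanCost_le (hm : 1 ≤ m) (hmε : m * ε ≤ γ) :
    ε * (1 - 4 * γ) * ∑ t ∈ Finset.range (T + 1), expect T m ε (meanCost D η f m t t) ≤
      2 * D * ℓ * ∑ t ∈ Finset.range (T + 1), expect T m ε (meanLoss D η f m t) +
        4 * D * m * ε := by
  have hℓ : (ℓ : ℝ) ≠ 0 := Nat.cast_ne_zero.2 (NeZero.ne ℓ)
  have h1 : ∀ t ∈ Finset.range (T + 1), ε * (1 - 4 * γ) * expect T m ε (meanCost D η f m t t) ≤
      2 * D * ℓ * expect T m ε (meanLoss D η f m t) + if t ≤ m then 2 * D * ε else 0 := by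
    intro t ht
    have htT := Nat.lt_succ_iff.1 (Finset.mem_range.1 ht)
    rw [expect_meanLoss htT]
    have h2 : 2 * D * ℓ * ((2 * D)⁻¹ * ((ℓ : ℝ)⁻¹ * expect T m ε
        (fun β e => (if timer m β t = 1 then 1 else 0) * meanCost D η f m t t β e))) =
        expect T m ε
        (fun β e => (if timer m β t = 1 then 1 else 0) * meanCost D η f m t t β e) := by
      field_simp
    rw [h2]
    -- For t ≤ m there is no lower bound on the chance of exploration; each of these at most m + 1 ≤
    -- 2m steps is charged the maximal cost 2D.
    split_ifs with htm
    · have h3 : expect T m ε (meanCost D η f m t t) ≤ 2 * D := by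
        rw [← expect_const (ℓ := ℓ) (T := T) (m := m) hε0 hε1 (2 * D)]
        exact expect_mono fun β e => meanCost_le hf1 t t β e
      have h4 : 0 ≤ expect T m ε (meanCost D η f m t t) :=
        expect_nonneg fun β e => meanCost_nonneg hf0 t t β e
      have h5 : 0 ≤ expect T m ε
          (fun β e => (if timer m β t = 1 then 1 else 0) * meanCost D η f m t t β e) :=
        expect_nonneg fun β e => mul_nonneg (by split_ifs <;> norm_num)
          (meanCost_nonneg hf0 t t β e)
      have h6 := mul_le_mul_of_nonneg_left h3 hε0
      have h7 := mul_nonneg (mul_nonneg hε0 hγ0) h4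
      nlinarith
    · rw [add_zero]
      exact expect_exploration_meanCost_ge hD hf0 hf1 hη hγ0 hγ1 hε0 hε1 hm hmε
        (not_le.1 htm) htT
  rw [Finset.mul_sum, Finset.mul_sum]
  refine (Finset.sum_le_sum h1).trans ?_
  rw [Finset.sum_add_distrib, ← Finset.sum_filter, Finset.sum_const, nsmul_eq_mul]
  refine add_le_add_right ?_ _
  have h8 : ((Finset.range (T + 1)).filter fun t => t ≤ m).card ≤ 2 * m := by
    calc _ ≤ (Finset.range (m + 1)).card := Finset.card_le_card fun t ht => by
          rw [Finset.mem_filter] at ht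
          exact Finset.mem_range.2 (by omega)
      _ ≤ 2 * m := by rw [Finset.card_range]; omega
  have h9 : (((Finset.range (T + 1)).filter fun t => t ≤ m).card : ℝ) ≤ 2 * m := by
    exact_mod_cast h8
  calc _ ≤ 2 * (m : ℝ) * (2 * D * ε) := mul_le_mul_of_nonneg_right h9 (by positivity)
    _ = _ := by ring

omit hf1 hη hγ0 hγ1 hε0 hε1 in
/-- The expected number of switches. -/
theorem sum_expect_movedMass_le (hη0 : 0 ≤ η) :
    ∑ t ∈ Finset.range (T + 1), expect T m ε (movedMass D η f m t) ≤
      η * ∑ t ∈ Finset.range (T + 1), expect T m ε (meanLoss D η f m t) := by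
  have h1 : expect T m ε (movedMass D η f m 0) = 0 := by simp [expect, movedMass_zero]
  rw [Finset.sum_range_succ', h1, add_zero, Finset.sum_range_succ, mul_add, Finset.mul_sum]
  have h2 : 0 ≤ η * expect T m ε (meanLoss D η f m T) :=
    mul_nonneg hη0 (expect_nonneg fun β e => meanLoss_nonneg hD hf0 T β e)
  refine le_trans (Finset.sum_le_sum fun t _ => ?_) (le_add_of_nonneg_right h2)
  rw [← expect_const_mul]
  exact expect_mono fun β e => movedMass_succ_le hD hf0 hη0 t β e

/-- A stale step forces a successful coin among the last 2m, unless t + 1 < m. Then the backlog is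
at most its value at t - 2m, independent of that coin, plus the window sum of mean costs, decoupled
from the coin, and of moved masses. Summing over t, the first contribution is at most γ times the
total backlog and is absorbed on the left. -/
theorem sum_expect_backlog_le (hm : 1 ≤ m) (hmε : 2 * m * ε ≤ γ) :
    (1 - γ) * ∑ t ∈ Finset.range (T + 1), expect T m ε
        (fun β e => backlog m β (fun u => meanStep D η f m u β e) t) ≤
      3 * D * m ^ 2 + 22 / 5 * m ^ 2 * ε *
        ∑ t ∈ Finset.range (T + 1), expect T m ε (meanCost D η f m t t) +
      2 * m * D * η * ∑ t ∈ Finset.range (T + 1), expect T m ε (meanLoss D η f m t) := by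
  have hη0 := nonneg_of_exp_neg hη hγ0
  set v : ℕ → (ℕ → Bool) → (ℕ → Fin ℓ) → ℝ :=
    fun t β e => backlog m β (fun u => meanStep D η f m u β e) t with hv
  have hstep0 : ∀ u β e, 0 ≤ meanStep D η f m u β e := fun u β e =>
    add_nonneg (meanCost_nonneg hf0 u u β e) (mul_nonneg hD.le (movedMass_nonneg u β e))
  have hstep1 : ∀ u β e, meanStep D η f m u β e ≤ 3 * D := fun u β e => by
    have h1 := meanCost_le (D := D) (η := η) (m := m) hf1 u u β e
    have h2 := mul_le_mul_of_nonneg_left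
      (movedMass_le_one (D := D) (η := η) (f := f) (m := m) u β e) hD.le
    rw [meanStep]
    linarith
  have hv0 : ∀ t β e, 0 ≤ v t β e := fun t β e => backlog_nonneg t fun u _ => hstep0 u β e
  -- The moved mass carries no coin indicator, since stability of the mean cost does not decouple
  -- it; its full window sum is small enough.
  have hpath : ∀ t β e, v t β e ≤ (if t < m then 3 * D * m else 0) +
      (∑ s ∈ Finset.Ico (t - 2 * m) t, ((if β s then 1 else 0) * v (t - 2 * m) β e +
        ∑ u ∈ Finset.Ioc (t - 2 * m) t, (if β s then 1 else 0) * meanCost D η f m u u β e)) +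
      ∑ u ∈ Finset.Ioc (t - 2 * m) t, D * movedMass D η f m u β e := by
    intro t β e
    have hterm : ∀ s ∈ Finset.Ico (t - 2 * m) t, 0 ≤ (if β s then 1 else 0) * v (t - 2 * m) β e +
        ∑ u ∈ Finset.Ioc (t - 2 * m) t,
          (if β s then 1 else 0) * meanCost D η f m u u β e := fun s _ =>
      add_nonneg (mul_nonneg (by split_ifs <;> norm_num) (hv0 _ _ _))
        (Finset.sum_nonneg fun u _ => mul_nonneg (by split_ifs <;> norm_num)
          (meanCost_nonneg hf0 u u β e))
    have hmass : 0 ≤ ∑ u ∈ Finset.Ioc (t - 2 * m) t, D * movedMass D η f m u β e :=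
      Finset.sum_nonneg fun u _ => mul_nonneg hD.le (movedMass_nonneg u β e)
    have hinit : (0 : ℝ) ≤ if t < m then 3 * D * m else 0 := by split_ifs <;> positivity
    have hsum := Finset.sum_nonneg hterm
    by_cases hs : Stale m β t
    · rcases hs.exists_coin with h | ⟨s, hs, hβ⟩
      · have h1 := backlog_le_add_sum (m := m) (β := β)
          (F := fun u => meanStep D η f m u β e) (Nat.zero_le t) fun u _ => hstep0 u β e
        have h2 : ∑ u ∈ Finset.Ioc 0 t, meanStep D η f m u β e ≤ 3 * D * m := by
          refine (Finset.sum_le_card_nsmul _ _ (3 * D) fun u _ => hstep1 u β e).trans ?_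
          rw [Nat.card_Ioc, nsmul_eq_mul, mul_comm]
          refine mul_le_mul_of_nonneg_left ?_ (by positivity)
          exact_mod_cast (by omega : t - 0 ≤ m)
        rw [if_pos (by omega)]
        have h3 : backlog m β (fun u => meanStep D η f m u β e) 0 = 0 := rfl
        simp only [hv] at *
        linarith
      · have h1 := backlog_le_add_sum (m := m) (β := β)
          (F := fun u => meanStep D η f m u β e) (Nat.sub_le t (2 * m)) fun u _ => hstep0 u β e
        have h2 := Finset.single_le_sum hterm hs
        simp only [if_pos hβ, one_mul] at h2
        simp only [meanStep, Finset.sum_add_distrib] at h1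
        simp only [hv, meanStep] at *
        linarith
    · have h1 : v t β e = 0 := backlog_eq_zero hs
      rw [h1]
      linarith
  set Y : ℕ → ℝ := fun t => expect T m ε (meanCost D η f m t t) with hY
  set G : ℕ → ℝ := fun t => expect T m ε (meanLoss D η f m t) with hG
  set V : ℕ → ℝ := fun t => expect T m ε (v t) with hV
  set U : ℕ → ℝ := fun t => expect T m ε (movedMass D η f m t) with hU
  have hY0 : ∀ t, 0 ≤ Y t := fun t => expect_nonneg fun β e => meanCost_nonneg hf0 t t β e
  have hV0 : ∀ t, 0 ≤ V t := fun t => expect_nonneg (hv0 t)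
  have hU0 : ∀ t, 0 ≤ U t := fun t => expect_nonneg (movedMass_nonneg t)
  have hUG : ∑ t ∈ Finset.range (T + 1), U t ≤ η * ∑ t ∈ Finset.range (T + 1), G t :=
    sum_expect_movedMass_le hD hf0 hη0
  -- The union over 2m coins gives 2mε; summing the windows of length 2m later produces another 2m,
  -- hence 22/5 = 2 · 2 · 11/10.
  have hVt : ∀ t ∈ Finset.range (T + 1), V t ≤ (if t < m then 3 * D * m else 0) +
      2 * m * ε * V (t - 2 * m) +
      2 * m * (11 / 10 * ε) * (∑ u ∈ Finset.Ioc (t - 2 * m) t, Y u) +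
      D * ∑ u ∈ Finset.Ioc (t - 2 * m) t, U u := by
    intro t ht
    have htT := Nat.lt_succ_iff.1 (Finset.mem_range.1 ht)
    have h1 := expect_mono (T := T) (m := m) (ε := ε) (hpath t)
    simp only [expect_add, expect_sum, expect_const hε0 hε1, expect_const_mul] at h1
    rw [← Finset.mul_sum] at h1
    have h2 : ∀ s ∈ Finset.Ico (t - 2 * m) t,
        expect T m ε (fun β e => (if β s then 1 else 0) * v (t - 2 * m) β e) +
        ∑ u ∈ Finset.Ioc (t - 2 * m) t,
          expect T m ε (fun β e => (if β s then 1 else 0) * meanCost D η f m u u β e) ≤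
        ε * V (t - 2 * m) + 11 / 10 * ε * ∑ u ∈ Finset.Ioc (t - 2 * m) t, Y u := by
      intro s hs
      rw [Finset.mem_Ico] at hs
      refine add_le_add ?_ ?_
      · refine expect_coin_mul_le hε0 hε1 (by omega) (hv0 _) fun β β' e h => ?_
        refine backlog_congr (fun u hu => h u (by omega)) fun u hu => ?_
        rw [meanStep, meanStep, meanCost_congr (fun w hw => h w (by omega)) fun _ _ => rfl,
          movedMass_congr (fun w hw => h w (by omega)) fun _ _ => rfl]
      · rw [Finset.mul_sum]
        refine Finset.sum_le_sum fun u hu => ?_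
        rw [Finset.mem_Ioc] at hu
        exact expect_coin_mul_meanCost_le hD hf0 hf1 hη hγ0 hγ1 hε0 hε1 (s := t - 2 * m)
          (by omega) (by omega) (by omega) (by omega) (by omega) (by omega)
    have h5 := Finset.sum_le_card_nsmul _ _ _ h2
    rw [nsmul_eq_mul, Nat.card_Ico] at h5
    have h3 : ((t - (t - 2 * m) : ℕ) : ℝ) ≤ 2 * m := by
      exact_mod_cast (by omega : t - (t - 2 * m) ≤ 2 * m)
    have h4 : 0 ≤ ε * V (t - 2 * m) + 11 / 10 * ε * ∑ u ∈ Finset.Ioc (t - 2 * m) t, Y u :=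
      add_nonneg (mul_nonneg hε0 (hV0 _))
        (mul_nonneg (by positivity) (Finset.sum_nonneg fun u _ => hY0 u))
    have h6 := mul_le_mul_of_nonneg_right h3 h4
    linarith
  have hsum := Finset.sum_le_sum hVt
  simp only [Finset.sum_add_distrib, ← Finset.mul_sum] at hsum
  -- Fewer than m steps of mean cost at most 2D + D each have accumulated, for at most m values of
  -- t.
  have hi : ∑ t ∈ Finset.range (T + 1), (if t < m then 3 * D * m else 0) ≤ 3 * D * m ^ 2 := by
    rw [← Finset.sum_filter, Finset.sum_const, nsmul_eq_mul]
    have h1 : ((Finset.range (T + 1)).filter fun t => t < m).card ≤ m := by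
      calc _ ≤ (Finset.range m).card := Finset.card_le_card fun t ht =>
            Finset.mem_range.2 (Finset.mem_filter.1 ht).2
        _ = m := Finset.card_range m
    have h2 : (((Finset.range (T + 1)).filter fun t => t < m).card : ℝ) ≤ m := by exact_mod_cast h1
    calc _ ≤ (m : ℝ) * (3 * D * m) := mul_le_mul_of_nonneg_right h2 (by positivity)
      _ = _ := by ring
  have h1 := sum_sub_le_sum (a := V) (by simp [hV, hv, expect, backlog]) hV0 (2 * m) (T + 1)
  have h2 := sum_sum_Ioc_le hY0 (2 * m) (T + 1)
  have h3 := sum_sum_Ioc_le hU0 (2 * m) (T + 1)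
  push_cast at h2 h3
  have hVs : 0 ≤ ∑ t ∈ Finset.range (T + 1), V t := Finset.sum_nonneg fun t _ => hV0 t
  have h4 : 2 * m * ε * ∑ t ∈ Finset.range (T + 1), V (t - 2 * m) ≤
      γ * ∑ t ∈ Finset.range (T + 1), V t :=
    mul_le_mul hmε h1 (Finset.sum_nonneg fun t _ => hV0 _) hγ0
  have h5 := mul_le_mul_of_nonneg_left h2 (show 0 ≤ 2 * m * (11 / 10 * ε) by positivity)
  have h6 := mul_le_mul_of_nonneg_left (h3.trans (mul_le_mul_of_nonneg_left hUG
    (by positivity : (0 : ℝ) ≤ 2 * m))) hD.le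
  linarith

end expected

/-- The bounds on the mean cost `X`, the loss `G`, the switches `Tm` and the backlog `V`, combined. -/
theorem total_cost_le {X G V Tm D η ε γ O m ℓ L : ℝ} (hm : 2 ≤ m) (hℓ : 2 ≤ ℓ) (hℓL : 1 ≤ ℓ * L)
    (hD : 0 < D) (hO : 0 < O) (hγ0 : 0 < γ) (hγ1 : γ ≤ 1 / 100) (hε : γ = m ^ 2 * ε)
    (hη0 : 0 ≤ η) (hη : η ≤ γ * (1 + 2 * γ)) (hG0 : 0 ≤ G)
    (hγ : D * ℓ * L * m ^ 2 = γ ^ 3 * O)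
    (hG : γ * G ≤ η * ((2 * D)⁻¹ * (ℓ⁻¹ * (ε * O))) + L)
    (hX : ε * (1 - 4 * γ) * X ≤ 2 * D * ℓ * G + 4 * D * m * ε)
    (hT : Tm ≤ η * G)
    (hV : (1 - γ) * V ≤ 3 * D * m ^ 2 + 22 / 5 * m ^ 2 * ε * X + 2 * m * D * η * G) :
    X + D * Tm + 2 * V ≤ O + 100 * (γ * O) := by
  have hε0 : 0 < ε := by
    by_contra hcon
    have : m ^ 2 * ε ≤ 0 := mul_nonpos_of_nonneg_of_nonpos (sq_nonneg m) (not_lt.1 hcon)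
    linarith
  have hγO : 0 < γ * O := mul_pos hγ0 hO
  have hm0 : 0 < m := by linarith
  have hℓ0 : 0 < ℓ := by linarith
  -- H is the loss of HEDGE rescaled to the units of cost, an estimate of X by exploration.
  obtain ⟨H, hH⟩ : ∃ H, 2 * D * ℓ * G = ε * H := ⟨2 * D * ℓ * G / ε, by field_simp⟩
  have hH0 : 0 ≤ H := by
    have : 0 ≤ ε * H := hH ▸ by positivity
    exact nonneg_of_mul_nonneg_right this hε0
  have hDL : D * ℓ * L = ε * (γ ^ 2 * O) := by
    have : m ^ 2 * (D * ℓ * L) = m ^ 2 * (ε * (γ ^ 2 * O)) := by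
      calc _ = γ ^ 3 * O := by rw [← hγ]; ring
        _ = γ * (γ ^ 2 * O) := by ring
        _ = _ := by nth_rewrite 1 [hε]; ring
    exact mul_left_cancel₀ (by positivity) this
  -- The excess 4γ consists of 2γ from η/γ ≤ 1 + 2γ and 2γ from the logarithmic term, via D ℓ L = ε
  -- γ² O.
  have hH1 : H ≤ (1 + 4 * γ) * O := by
    have h1 := mul_le_mul_of_nonneg_left hG (by positivity : 0 ≤ 2 * D * ℓ)
    have h2 : 2 * D * ℓ * (η * ((2 * D)⁻¹ * (ℓ⁻¹ * (ε * O))) + L) =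
        ε * (η * O + 2 * (γ ^ 2 * O)) := by
      have : 2 * D * ℓ * (η * ((2 * D)⁻¹ * (ℓ⁻¹ * (ε * O)))) = ε * (η * O) := by
        field_simp
      rw [mul_add, this]
      linear_combination 2 * hDL
    rw [h2, mul_left_comm, hH, mul_left_comm] at h1
    have h3 := le_of_mul_le_mul_left h1 hε0
    have h4 := mul_le_mul_of_nonneg_right hη hO.le
    have h5 : γ * H ≤ γ * ((1 + 4 * γ) * O) := by linarith
    exact le_of_mul_le_mul_left h5 hγ0
  -- The additive start-up costs are absorbed here, using ℓ L ≥ 1.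
  have hDm2 : D * m ^ 2 ≤ γ * O / 100 := by
    have h1 : D * m ^ 2 * 1 ≤ D * m ^ 2 * (ℓ * L) :=
      mul_le_mul_of_nonneg_left hℓL (by positivity)
    have h2 : γ ^ 3 * O = γ ^ 2 * (γ * O) := by ring
    have h3 : γ ^ 2 ≤ 1 / 100 := by nlinarith
    have h4 := mul_le_mul_of_nonneg_right h3 hγO.le
    linarith
  have hDm : D * m ≤ D * m ^ 2 := by
    refine mul_le_mul_of_nonneg_left ?_ hD.le
    nlinarith
  have hX1 : X ≤ (1 + 10 * γ) * O := by
    rw [hH] at hX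
    have h1 : ε * ((1 - 4 * γ) * X) ≤ ε * (H + 4 * D * m) := by linarith
    have h2 := le_of_mul_le_mul_left h1 hε0
    have h3 : (1 - 4 * γ) * X ≤ (1 - 4 * γ) * ((1 + 10 * γ) * O) := by
      have h4 : γ * (γ * O) ≤ 1 / 100 * (γ * O) := mul_le_mul_of_nonneg_right hγ1 hγO.le
      have h5 : (1 - 4 * γ) * ((1 + 10 * γ) * O) = O + 6 * (γ * O) - 40 * (γ * (γ * O)) := by ring
      rw [h5]
      linarith
    exact le_of_mul_le_mul_left h3 (by linarith)
  have hmε : m * ε ≤ 1 / 200 := by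
    have : m ^ 2 * ε = m * (m * ε) := by ring
    have h1 : 2 * (m * ε) ≤ m * (m * ε) := mul_le_mul_of_nonneg_right hm (by positivity)
    linarith
  have hH2 : H ≤ 2 * O := by nlinarith
  have hηγ : η ≤ 2 * γ := by nlinarith
  -- Since γ = m · (mε) and m ≥ 2, the factor mε is small, while η H is of order γ O.
  have hDG : 2 * m * D * η * G ≤ γ * O := by
    have h1 : ℓ * (2 * m * D * η * G) = m * ε * (η * H) := by
      calc _ = m * η * (2 * D * ℓ * G) := by ring
        _ = _ := by rw [hH]; ring
    have h2 : η * H ≤ 2 * γ * (2 * O) := mul_le_mul hηγ hH2 hH0 (by positivity)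
    have h3 : m * ε * (η * H) ≤ 1 / 200 * (2 * γ * (2 * O)) :=
      mul_le_mul hmε h2 (by positivity) (by norm_num)
    have h4 : 0 ≤ 2 * m * D * η * G := by positivity
    have h5 : 1 * (2 * m * D * η * G) ≤ ℓ * (2 * m * D * η * G) :=
      mul_le_mul_of_nonneg_right (by linarith) h4
    linarith
  have hDT : D * Tm ≤ γ * O := by
    have h1 := mul_le_mul_of_nonneg_left hT hD.le
    have h2 : 1 * (D * (η * G)) ≤ 2 * m * (D * (η * G)) :=
      mul_le_mul_of_nonneg_right (by linarith) (by positivity)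
    linarith
  have hV1 : V ≤ 10 * (γ * O) := by
    have h1 : m ^ 2 * ε * X ≤ γ * ((1 + 10 * γ) * O) := by
      rw [← hε]
      exact mul_le_mul_of_nonneg_left hX1 hγ0.le
    have h2 : γ * (γ * O) ≤ 1 / 100 * (γ * O) := mul_le_mul_of_nonneg_right hγ1 hγO.le
    have h3 : (1 - γ) * V ≤ (1 - γ) * (10 * (γ * O)) := by linarith
    exact le_of_mul_le_mul_left h3 (by linarith)
  linarith

end

/-! ### Runs of the algorithm -/

section run

variable {M : Type*} [MetricSpace M] {ℓ : ℕ} (I : Instance M ℓ)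

/-- The costs of the heuristics as real numbers, extended by zero. -/
def Instance.realCost (t : ℕ) (j : Fin ℓ) : ℝ :=
  if t ∈ Finset.Icc 1 I.T then (I.f t j).toReal else 0

theorem Instance.realCost_nonneg (t : ℕ) (j : Fin ℓ) : 0 ≤ I.realCost t j := by
  rw [Instance.realCost]
  split_ifs
  · exact ENNReal.toReal_nonneg
  · exact le_rfl

theorem Instance.realCost_le {D : ℝ} (hD : 0 ≤ D)
    (hf : ∀ t ∈ Finset.Icc 1 I.T, ∀ i, I.f t i ≤ ENNReal.ofReal (2 * D)) (t : ℕ) (j : Fin ℓ) :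
    I.realCost t j ≤ 2 * D := by
  rw [Instance.realCost]
  split_ifs with h
  · exact ENNReal.toReal_le_of_le_ofReal (by linarith) (hf t h j)
  · linarith

theorem Instance.f_eq_ofReal {D : ℝ}
    (hf : ∀ t ∈ Finset.Icc 1 I.T, ∀ i, I.f t i ≤ ENNReal.ofReal (2 * D)) {t : ℕ}
    (ht : t ∈ Finset.Icc 1 I.T) (j : Fin ℓ) : I.f t j = ENNReal.ofReal (I.realCost t j) := by
  rw [Instance.realCost, if_pos ht,
    ENNReal.ofReal_toReal (ne_top_of_le_ne_top ENNReal.ofReal_ne_top (hf t ht j))]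

omit [MetricSpace M] in
theorem answer_eq_some {m : ℕ} {H : Fin ℓ → ℕ → M} {q : ℕ → Fin ℓ} {t : ℕ} (hm : m ≤ t + 1)
    (hq : ∀ u ≤ t, t + 2 ≤ u + m → q u = q t) : answer m H q t = some (H (q t) t) :=
  if_pos ⟨hm, hq⟩

/-- The losses fed to HEDGE do not depend on the exploited heuristics. -/
theorem loss_eq_explorationLoss {D : ℝ} {m : ℕ} (hm : 2 ≤ m) {β : ℕ → Bool} {e i : ℕ → Fin ℓ}
    {t : ℕ} (ht : t ≤ I.T) :
    loss D I.c (timer m β) (query m β e i) (I.answers m β e i) t =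
      explorationLoss D I.realCost m β e t := by
  ext j
  rw [loss, explorationLoss]
  by_cases h : timer m β t = 1
  · have hq : ∀ k < m, query m β e i (t - k) = e t := by
      intro k hk
      obtain ⟨h1, h2⟩ := timer_sub_of_timer_eq_one h hk
      rw [query, h1, if_neg (Nat.succ_ne_zero k)]
      congr 1
      omega
    have hmt := (timer_sub_of_timer_eq_one h (k := 0) (by omega)).2
    have hqt : query m β e i t = e t := hq 0 (by omega)
    have hqu : ∀ u ≤ t, t + 1 ≤ u + m → query m β e i u = e t := by
      intro u hu hum
      have := hq (t - u) (by omega)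
      rwa [Nat.sub_sub_self hu] at this
    have hq1 : query m β e i (t - 1) = e t := hq 1 (by omega)
    have ha : I.answers m β e i t = some (I.H (e t) t) := by
      rw [← hqt]
      exact answer_eq_some (by omega) fun u hu hum => by rw [hqu u hu (by omega), hqt]
    have ha1 : I.answers m β e i (t - 1) = some (I.H (e t) (t - 1)) := by
      rw [← hq1]
      exact answer_eq_some (by omega) fun u hu hum => by
        rw [hqu u (by omega) (by omega), hq1]
    rw [ha, ha1, hqt, h]
    by_cases hj : j = e t
    · rw [if_pos ⟨rfl, hj⟩, if_pos ⟨rfl, hj⟩, Instance.realCost,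
        if_pos (Finset.mem_Icc.2 ⟨by omega, ht⟩), hj]
      rfl
    · rw [if_neg fun h => hj h.2, if_neg fun h => hj h.2]
  · rw [if_neg fun h' => h h'.1, if_neg fun h' => h h'.1]

theorem dist_eq_learned {D η : ℝ} {m : ℕ} (hm : 2 ≤ m) {β : ℕ → Bool} {e i : ℕ → Fin ℓ}
    {t : ℕ} (ht : t ≤ I.T) :
    I.dist D m η β e i t = learned D η I.realCost m β e t :=
  hedge_congr fun u hu => loss_eq_explorationLoss I hm (by omega)

theorem pathProb_congr {R : (Fin ℓ → ℝ) → (Fin ℓ → ℝ) → Fin ℓ → PMF (Fin ℓ)} {T : ℕ}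
    {x x' : ℕ → Fin ℓ → ℝ} (h : ∀ t ≤ T, x t = x' t) (i : ℕ → Fin ℓ) :
    pathProb R T x i = pathProb R T x' i := by
  rw [pathProb, pathProb]
  congr 1
  refine Finset.prod_congr rfl fun t ht => ?_
  rw [Finset.mem_Icc] at ht
  rw [h t ht.2, h (t - 1) (by omega)]

/-- The cost of the exploited heuristic at time `t`, including the movement due to a switch. -/
def Instance.followCost (D : ℝ) (i : ℕ → Fin ℓ) (t : ℕ) : ℝ :=
  I.realCost t (i t) + D * if i t ≠ i (t - 1) then 1 else 0

variable {D : ℝ} {m : ℕ} {β : ℕ → Bool} {e i : ℕ → Fin ℓ} {greedy : ℕ → M → M}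

theorem Instance.followCost_nonneg (hD : 0 ≤ D) (t : ℕ) : 0 ≤ I.followCost D i t :=
  add_nonneg (I.realCost_nonneg _ _) (mul_nonneg hD (by split_ifs <;> norm_num))

/-- A switch is paid first, at the old time, by a jump of length at most D; then the new heuristic
is followed for one step. -/
theorem Instance.follow_le (hdiam : ∀ a b : M, edist a b ≤ ENNReal.ofReal D) (hD : 0 ≤ D)
    (hf : ∀ t ∈ Finset.Icc 1 I.T, ∀ i, I.f t i ≤ ENNReal.ofReal (2 * D)) {t : ℕ}
    (ht : t + 1 ≤ I.T) :
    edist (I.H (i t) t) (I.H (i (t + 1)) (t + 1)) + I.c (t + 1) (I.H (i (t + 1)) (t + 1)) ≤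
      ENNReal.ofReal (I.followCost D i (t + 1)) := by
  have h1 : edist (I.H (i t) t) (I.H (i (t + 1)) t) ≤
      ENNReal.ofReal (D * if i (t + 1) ≠ i t then 1 else 0) := by
    by_cases h : i (t + 1) = i t
    · simp [h]
    · rw [if_pos h, mul_one]
      exact hdiam _ _
  have h2 : edist (I.H (i (t + 1)) t) (I.H (i (t + 1)) (t + 1)) +
      I.c (t + 1) (I.H (i (t + 1)) (t + 1)) =
      ENNReal.ofReal (I.realCost (t + 1) (i (t + 1))) := by
    rw [← I.f_eq_ofReal hf (Finset.mem_Icc.2 ⟨by omega, ht⟩), Instance.f, add_comm]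
    rfl
  rw [Instance.followCost, ENNReal.ofReal_add (I.realCost_nonneg _ _)
    (mul_nonneg hD (by split_ifs <;> norm_num)), ← h2, Nat.add_sub_cancel]
  calc _ ≤ edist (I.H (i t) t) (I.H (i (t + 1)) t) +
        edist (I.H (i (t + 1)) t) (I.H (i (t + 1)) (t + 1)) +
        I.c (t + 1) (I.H (i (t + 1)) (t + 1)) := by gcongr; exact edist_triangle _ _ _
    _ ≤ ENNReal.ofReal (D * if i (t + 1) ≠ i t then 1 else 0) +
        edist (I.H (i (t + 1)) t) (I.H (i (t + 1)) (t + 1)) +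
        I.c (t + 1) (I.H (i (t + 1)) (t + 1)) := by gcongr
    _ = _ := by rw [add_assoc, add_comm]

omit [MetricSpace M] in
theorem known_eq_none_or (t : ℕ) :
    known (query m β e i) i (I.answers m β e i) t = none ∨
      known (query m β e i) i (I.answers m β e i) t = some (I.H (i t) t) := by
  rw [known]
  split_ifs with h
  · rw [Instance.answers, answer]
    split_ifs
    · rw [h]; exact Or.inr rfl
    · exact Or.inl rfl
  · exact Or.inl rfl

omit [MetricSpace M] in
-- A switch directly follows an exploration step. Without a block in the last m - 1 steps, the same
-- heuristic was therefore exploited and queried throughout, so its state is revealed.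
theorem stale_of_known_eq_none (hm : 2 ≤ m) (hsw : ∀ t < I.T, i (t + 1) ≠ i t → timer m β t = 1)
    {t : ℕ} (ht : t ≤ I.T) (h : known (query m β e i) i (I.answers m β e i) t = none) :
    Stale m β t := by
  by_contra hs
  rw [Stale, not_or] at hs
  push Not at hs
  obtain ⟨h1, h2⟩ := hs
  have hi : ∀ k, k + 2 ≤ m → k ≤ t → i (t - k) = i t := by
    intro k hk hkt
    induction k with
    | zero => rfl
    | succ k ih =>
      rw [← ih (by omega) (by omega)]
      by_contra hne
      have h3 := hsw (t - (k + 1)) (by omega) (by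
        rw [show t - (k + 1) + 1 = t - k by omega]; exact Ne.symm hne)
      have h4 := h2 (t - (k + 1)) (by omega) (by omega)
      omega
  have hq : ∀ u ≤ t, t + 2 ≤ u + m → query m β e i u = i t := by
    intro u hu hum
    rw [query, if_pos (h2 u hu hum), ← hi (t - u) (by omega) (by omega), Nat.sub_sub_self hu]
  have hqt := hq t le_rfl (by omega)
  rw [known, if_pos hqt, Instance.answers,
    answer_eq_some (by omega) fun u hu hum => by rw [hq u hu hum, hqt]] at h
  exact absurd h (Option.some_ne_none _)

variable (hdiam : ∀ a b : M, edist a b ≤ ENNReal.ofReal D) (hD : 0 ≤ D)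
  (hf : ∀ t ∈ Finset.Icc 1 I.T, ∀ i, I.f t i ≤ ENNReal.ofReal (2 * D))
  (hgreedy : IsGreedy I greedy) (hm : 2 ≤ m)
  (hsw : ∀ t < I.T, i (t + 1) ≠ i t → timer m β t = 1)

include hdiam hD hf hm hsw

/-- A revealed state resets the distance to zero; otherwise the base point rests and the target
moves by at most `followCost`. -/
theorem edist_lastKnown_le {t : ℕ} (ht : t ≤ I.T) :
    edist (lastKnown I.s₀ (query m β e i) i (I.answers m β e i) t) (I.H (i t) t) ≤
      ENNReal.ofReal (backlog m β (I.followCost D i) t) := by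
  induction t with
  | zero => simp [lastKnown, I.H_zero]
  | succ t ih =>
    rcases known_eq_none_or I (m := m) (β := β) (e := e) (i := i) (t + 1) with h | h
    · rw [lastKnown, h, Option.getD_none, backlog,
        if_pos (stale_of_known_eq_none I hm hsw ht h),
        ENNReal.ofReal_add (backlog_nonneg _ fun u _ => I.followCost_nonneg hD u)
          (I.followCost_nonneg hD _)]
      exact (edist_triangle _ (I.H (i t) t) _).trans (add_le_add (ih (by omega))
        (le_self_add.trans (I.follow_le hdiam hD hf ht)))
    · rw [lastKnown, h, Option.getD_some, edist_self]
      exact zero_le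

include hgreedy

/-- The greedy point is compared with the current state of the exploited heuristic, which is unknown
but admissible as a competitor. -/
theorem greedy_step_le {t : ℕ} (ht : t + 1 ≤ I.T)
    (h : known (query m β e i) i (I.answers m β e i) (t + 1) = none) :
    edist (lastKnown I.s₀ (query m β e i) i (I.answers m β e i) t)
        (position I.s₀ greedy (query m β e i) i (I.answers m β e i) (t + 1)) +
      I.c (t + 1) (position I.s₀ greedy (query m β e i) i (I.answers m β e i) (t + 1)) ≤
      ENNReal.ofReal (backlog m β (I.followCost D i) t) +
        ENNReal.ofReal (I.followCost D i (t + 1)) := by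
  rw [position, h, Option.getD_none, lastKnown, h, Option.getD_none]
  set b := lastKnown I.s₀ (query m β e i) i (I.answers m β e i) t with hb
  refine (hgreedy _ (Finset.mem_Icc.2 ⟨by omega, ht⟩) b (I.H (i (t + 1)) (t + 1))).trans ?_
  calc _ ≤ edist b (I.H (i t) t) + edist (I.H (i t) t) (I.H (i (t + 1)) (t + 1)) +
        I.c (t + 1) (I.H (i (t + 1)) (t + 1)) := by gcongr; exact edist_triangle _ _ _
    _ ≤ _ := by
      rw [add_assoc]
      exact add_le_add (edist_lastKnown_le I hdiam hD hf hm hsw (by omega))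
        (I.follow_le hdiam hD hf ht)

theorem edist_position_le {t : ℕ} (ht : t ≤ I.T) :
    edist (position I.s₀ greedy (query m β e i) i (I.answers m β e i) t)
        (lastKnown I.s₀ (query m β e i) i (I.answers m β e i) t) ≤
      ENNReal.ofReal (backlog m β (I.followCost D i) t) := by
  cases t with
  | zero => simp [lastKnown, position]
  | succ t =>
    rcases known_eq_none_or I (m := m) (β := β) (e := e) (i := i) (t + 1) with h | h
    · have := greedy_step_le (e := e) I hdiam hD hf hgreedy hm hsw ht h
      rw [backlog, if_pos (stale_of_known_eq_none I hm hsw ht h),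
        ENNReal.ofReal_add (backlog_nonneg _ fun u _ => I.followCost_nonneg hD u)
          (I.followCost_nonneg hD _), edist_comm, lastKnown, h, Option.getD_none]
      exact le_self_add.trans this
    · rw [position, lastKnown, h, Option.getD_some, Option.getD_some, edist_self]
      exact zero_le

/-- The move is routed through the base point: returning to it costs one backlog, and leaving it for
the next position costs another plus the new `followCost`. -/
theorem step_cost_le {t : ℕ} (ht : t + 1 ≤ I.T) :
    I.c (t + 1) (position I.s₀ greedy (query m β e i) i (I.answers m β e i) (t + 1)) +
      edist (position I.s₀ greedy (query m β e i) i (I.answers m β e i) t)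
        (position I.s₀ greedy (query m β e i) i (I.answers m β e i) (t + 1)) ≤
      ENNReal.ofReal (I.followCost D i (t + 1) + 2 * backlog m β (I.followCost D i) t) := by
  have hv := backlog_nonneg (m := m) (β := β) t fun u _ => I.followCost_nonneg (i := i) hD u
  have hF := I.followCost_nonneg (i := i) hD (t + 1)
  have h1 := edist_position_le (e := e) I hdiam hD hf hgreedy hm hsw (t := t) (by omega)
  rw [show I.followCost D i (t + 1) + 2 * backlog m β (I.followCost D i) t =
    backlog m β (I.followCost D i) t + (backlog m β (I.followCost D i) t +
      I.followCost D i (t + 1)) by ring, ENNReal.ofReal_add hv (add_nonneg hv hF),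
    ENNReal.ofReal_add hv hF]
  set b := lastKnown I.s₀ (query m β e i) i (I.answers m β e i) t with hb
  set s := position I.s₀ greedy (query m β e i) i (I.answers m β e i) with hs
  have h2 : edist b (s (t + 1)) + I.c (t + 1) (s (t + 1)) ≤
      ENNReal.ofReal (backlog m β (I.followCost D i) t) +
        ENNReal.ofReal (I.followCost D i (t + 1)) := by
    rcases known_eq_none_or I (m := m) (β := β) (e := e) (i := i) (t + 1) with h | h
    · exact greedy_step_le I hdiam hD hf hgreedy hm hsw ht h
    · rw [hs, position, h, Option.getD_some]
      calc _ ≤ edist b (I.H (i t) t) + edist (I.H (i t) t) (I.H (i (t + 1)) (t + 1)) +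
            I.c (t + 1) (I.H (i (t + 1)) (t + 1)) := by gcongr; exact edist_triangle _ _ _
        _ ≤ _ := by
          rw [add_assoc]
          exact add_le_add (edist_lastKnown_le I hdiam hD hf hm hsw (by omega))
            (I.follow_le hdiam hD hf ht)
  calc _ ≤ I.c (t + 1) (s (t + 1)) + (edist (s t) b + edist b (s (t + 1))) := by
        gcongr; exact edist_triangle _ _ _
    _ = edist (s t) b + (edist b (s (t + 1)) + I.c (t + 1) (s (t + 1))) := by ring
    _ ≤ _ := add_le_add h1 h2

/-- The cost of a run of the algorithm. -/
theorem cost_le :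
    I.cost greedy m β e i ≤ ENNReal.ofReal (∑ t ∈ Finset.range (I.T + 1),
      (I.followCost D i t + 2 * backlog m β (I.followCost D i) t)) := by
  have hv := fun t => backlog_nonneg (m := m) (β := β) t
    fun u _ => I.followCost_nonneg (i := i) hD u
  have hF := fun t => I.followCost_nonneg (i := i) hD t
  have h1 : I.cost greedy m β e i ≤ ∑ t ∈ Finset.range I.T,
      ENNReal.ofReal (I.followCost D i (t + 1) + 2 * backlog m β (I.followCost D i) t) := by
    have h2 := Finset.sum_Ico_add'
      (fun t => I.c t (position I.s₀ greedy (query m β e i) i (I.answers m β e i) t) +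
        edist (position I.s₀ greedy (query m β e i) i (I.answers m β e i) (t - 1))
          (position I.s₀ greedy (query m β e i) i (I.answers m β e i) t)) 0 I.T 1
    rw [← Finset.range_eq_Ico] at h2
    refine (le_of_eq h2.symm).trans ?_
    refine Finset.sum_le_sum fun t ht => ?_
    exact step_cost_le I hdiam hD hf hgreedy hm hsw (Finset.mem_range.1 ht)
  refine h1.trans ?_
  rw [← ENNReal.ofReal_sum_of_nonneg fun t _ => add_nonneg (hF _) (mul_nonneg zero_le_two (hv t))]
  refine ENNReal.ofReal_le_ofReal ?_
  rw [Finset.sum_add_distrib, Finset.sum_add_distrib, Finset.sum_range_succ' (I.followCost D i),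
    Finset.sum_range_succ fun t => 2 * backlog m β (I.followCost D i) t]
  have h2 := hF 0
  have h3 := hv I.T
  linarith

end run

/-! ### The expected cost of the algorithm -/

/-- For fixed β the reset times are fixed, so the backlog is linear in the accumulated costs. -/
theorem pathExpect_backlog {ℓ m : ℕ} {R : (Fin ℓ → ℝ) → (Fin ℓ → ℝ) → Fin ℓ → PMF (Fin ℓ)} {T : ℕ}
    {x : ℕ → Fin ℓ → ℝ} {β : ℕ → Bool}
    {F : (ℕ → Fin ℓ) → ℕ → ℝ} {F' : ℕ → ℝ}
    (hF : ∀ t ≤ T, pathExpect R T x (fun i => F i t) = F' t) {t : ℕ} (ht : t ≤ T) :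
    pathExpect R T x (fun i => backlog m β (F i) t) = backlog m β F' t := by
  induction t with
  | zero => simp [backlog, pathExpect]
  | succ t ih =>
    by_cases h : Stale m β (t + 1)
    · simp only [backlog, if_pos h]
      rw [pathExpect_add, ih (by omega), hF _ ht]
    · simp only [backlog, if_neg h]
      simp [pathExpect]

section total

variable {M : Type*} [MetricSpace M] {ℓ : ℕ} [NeZero ℓ] (I : Instance M ℓ)
  {R : (Fin ℓ → ℝ) → (Fin ℓ → ℝ) → Fin ℓ → PMF (Fin ℓ)} {greedy : ℕ → M → M}
  {D η : ℝ} {m : ℕ}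

theorem learned_mem_stdSimplex (f : ℕ → Fin ℓ → ℝ) (β : ℕ → Bool) (e : ℕ → Fin ℓ) (t : ℕ) :
    learned D η f m β e t ∈ stdSimplex ℝ (Fin ℓ) :=
  hedge_mem_stdSimplex _ _ _

theorem learned_zero (f : ℕ → Fin ℓ → ℝ) (β : ℕ → Bool) (e : ℕ → Fin ℓ) (j : Fin ℓ) :
    learned D η f m β e 0 j = (ℓ : ℝ)⁻¹ :=
  hedge_zero _ _ _

theorem pathExpect_followCost (hR : IsRound R) (β : ℕ → Bool) (e : ℕ → Fin ℓ) {t : ℕ}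
    (ht : t ≤ I.T) :
    pathExpect R I.T (learned D η I.realCost m β e) (fun i => I.followCost D i t) =
      meanStep D η I.realCost m t β e := by
  simp only [Instance.followCost]
  rw [pathExpect_add, pathExpect_const_mul, meanStep,
    pathExpect_apply hR (learned_mem_stdSimplex _ β e) (learned_pos β e)
      (learned_zero _ β e) (I.realCost t) ht]
  congr 2
  cases t with
  | zero => simp [pathExpect, movedMass_zero]
  | succ t =>
    exact pathExpect_switch hR (learned_mem_stdSimplex _ β e) (learned_pos β e)
      (learned_zero _ β e) ht

theorem expectedCost_le_ofReal_expect (hR : IsRound R)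
    (hdiam : ∀ a b : M, edist a b ≤ ENNReal.ofReal D) (hD : 0 ≤ D)
    (hf : ∀ t ∈ Finset.Icc 1 I.T, ∀ i, I.f t i ≤ ENNReal.ofReal (2 * D))
    (hgreedy : IsGreedy I greedy) (hm : 2 ≤ m) (ε : ℝ) :
    I.expectedCost greedy R D m ε η ≤ ENNReal.ofReal (expect I.T m ε fun β e =>
      ∑ t ∈ Finset.range (I.T + 1), (meanStep D η I.realCost m t β e +
        2 * backlog m β (fun u => meanStep D η I.realCost m u β e) t)) := by
  have hpath : ∀ β e, ∑ t ∈ Finset.range (I.T + 1), (meanStep D η I.realCost m t β e +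
        2 * backlog m β (fun u => meanStep D η I.realCost m u β e) t) =
      pathExpect R I.T (learned D η I.realCost m β e) fun i => ∑ t ∈ Finset.range (I.T + 1),
        (I.followCost D i t + 2 * backlog m β (I.followCost D i) t) := by
    intro β e
    rw [pathExpect_sum]
    refine Finset.sum_congr rfl fun t ht => ?_
    have htT := Nat.lt_succ_iff.1 (Finset.mem_range.1 ht)
    rw [pathExpect_add, pathExpect_const_mul, pathExpect_followCost I hR β e htT,
      pathExpect_backlog (fun u hu => pathExpect_followCost I hR β e hu) htT]
  have hterm : ∀ (β : Fin (I.T + 1) → Bool) (e : Fin (I.T + m + 1) → Fin ℓ)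
      (i : Fin (I.T + 1) → Fin ℓ),
      0 ≤ (coinProb I.T ε (ext β)).toReal * (ℓ : ℝ)⁻¹ ^ (I.T + m + 1) *
        ((pathProb R I.T (learned D η I.realCost m (ext β) (ext e)) (ext i)).toReal *
          ∑ t ∈ Finset.range (I.T + 1), (I.followCost D (ext i) t +
            2 * backlog m (ext β) (I.followCost D (ext i)) t)) := fun β e i => by
    have : 0 ≤ ∑ t ∈ Finset.range (I.T + 1), (I.followCost D (ext i) t +
        2 * backlog m (ext β) (I.followCost D (ext i)) t) :=
      Finset.sum_nonneg fun t _ => add_nonneg (I.followCost_nonneg hD t) (mul_nonneg zero_le_two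
        (backlog_nonneg t fun u _ => I.followCost_nonneg hD u))
    positivity
  simp only [hpath, expect, pathExpect,
    Finset.mul_sum (Finset.univ : Finset (Fin (I.T + 1) → Fin ℓ))]
  rw [Instance.expectedCost, ENNReal.ofReal_sum_of_nonneg fun β _ => Finset.sum_nonneg fun e _ =>
    Finset.sum_nonneg fun i _ => hterm β e i]
  refine Finset.sum_le_sum fun β _ => ?_
  rw [ENNReal.ofReal_sum_of_nonneg fun e _ =>
    Finset.sum_nonneg fun i _ => hterm β e i]
  refine Finset.sum_le_sum fun e _ => ?_
  rw [ENNReal.ofReal_sum_of_nonneg fun i _ => hterm β e i]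
  refine Finset.sum_le_sum fun i _ => ?_
  rw [pathProb_congr fun t ht => dist_eq_learned I hm ht]
  -- A path of probability zero may switch at any time, so the pathwise bound is used only on the
  -- other ones.
  by_cases h0 : pathProb R I.T (learned D η I.realCost m (ext β) (ext e)) (ext i) = 0
  · rw [h0]
    simp
  have hsw : ∀ t < I.T, ext i (t + 1) ≠ ext i t → timer m (ext β) t = 1 := by
    intro t ht hne
    by_contra h1
    refine hne (eq_of_pathProb_ne_zero h0 (Finset.mem_Icc.2 ⟨by omega, ht⟩) ?_)
    exact learned_succ_of_timer_ne_one h1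
  refine (mul_le_mul_right (cost_le I hdiam hD hf hgreedy hm hsw) _).trans (le_of_eq ?_)
  rw [ENNReal.ofReal_mul (by positivity), ENNReal.ofReal_mul (by positivity),
    ENNReal.ofReal_mul (by positivity), ENNReal.ofReal_toReal (coinProb_ne_top _),
    ENNReal.ofReal_toReal (pathProb_ne_top _ _ _ _), ENNReal.ofReal_pow (by positivity),
    ENNReal.ofReal_inv_of_pos (Nat.cast_pos.2 (NeZero.pos ℓ)), ENNReal.ofReal_natCast]
  ring

end total

/-! ### Parameters -/

section params

variable {D OPT : ℝ} {ℓ m : ℕ}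

theorem gammaParam_eq_sq_mul_epsParam (hm : 0 < m) :
    gammaParam D ℓ m OPT = (m : ℝ) ^ 2 * epsParam D ℓ m OPT := by
  have hm' : (0 : ℝ) < m := Nat.cast_pos.2 hm
  have : (m : ℝ) ^ (2 / 3 : ℝ) = (m : ℝ) ^ 2 * (m : ℝ) ^ (-4 / 3 : ℝ) := by
    rw [← Real.rpow_natCast, ← Real.rpow_add hm']
    norm_num
  rw [gammaParam, epsParam, this]
  ring

/-- The balance between regret and backlog; besides γ = m²ε, this is all that the estimate uses
about the parameters. -/
theorem gammaParam_pow_three_mul (ha : 0 ≤ D * ℓ * Real.log ℓ) (hO : 0 < OPT) :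
    gammaParam D ℓ m OPT ^ 3 * OPT = D * ℓ * Real.log ℓ * (m : ℝ) ^ 2 := by
  have h1 : ∀ {y : ℝ} (_ : 0 ≤ y) (a b : ℝ), a * 3 = b → (y ^ a) ^ 3 = y ^ b := by
    intro y hy a b hab
    rw [← Real.rpow_natCast, ← Real.rpow_mul hy, ← hab]
    norm_num
  rw [gammaParam, mul_pow, mul_pow, h1 ha _ 1 (by norm_num),
    h1 (Nat.cast_nonneg m) _ ((2 : ℕ) : ℝ) (by norm_num), h1 hO.le _ (-1) (by norm_num),
    Real.rpow_one, Real.rpow_natCast, Real.rpow_neg_one, mul_assoc, inv_mul_cancel₀ hO.ne',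
    mul_one]

theorem gammaParam_mul_opt (hO : 0 < OPT) :
    gammaParam D ℓ m OPT * OPT =
      (D * ℓ * Real.log ℓ) ^ (1 / 3 : ℝ) * (m : ℝ) ^ (2 / 3 : ℝ) * OPT ^ (2 / 3 : ℝ) := by
  have : OPT ^ (-1 / 3 : ℝ) * OPT = OPT ^ (2 / 3 : ℝ) := by
    nth_rewrite 2 [← Real.rpow_one OPT]
    rw [← Real.rpow_add hO]
    norm_num
  rw [gammaParam, mul_assoc, this]

/-- Cubing the hypothesis and cancelling D², with D₀ ≤ D, gives D ℓ³ m³ ≤ OPT/100³, which dominates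
γ³ OPT because ln ℓ ≤ ℓ. -/
theorem gammaParam_le {D₀ : ℝ} (hD₀ : 0 < D₀) (hD : D₀ ≤ D) (hℓ : 2 ≤ ℓ) (hm : 2 ≤ m)
    (hO : 0 < OPT) (h : D * ℓ * m ≤ D₀ ^ (2 / 3 : ℝ) / 100 * OPT ^ (1 / 3 : ℝ)) :
    gammaParam D ℓ m OPT ≤ 1 / 100 := by
  have hℓ' : (2 : ℝ) ≤ ℓ := by exact_mod_cast hℓ
  have hm' : (2 : ℝ) ≤ m := by exact_mod_cast hm
  have hDpos : 0 < D := hD₀.trans_le hD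
  have hlog : 0 ≤ Real.log ℓ := Real.log_nonneg (by linarith)
  have hlog1 : Real.log ℓ ≤ ℓ := (Real.log_le_sub_one_of_pos (by linarith)).trans (by linarith)
  have h1 := pow_le_pow_left₀ (by positivity) h 3
  have h2 : (D₀ ^ (2 / 3 : ℝ)) ^ 3 = D₀ ^ 2 := by
    rw [← Real.rpow_natCast, ← Real.rpow_mul hD₀.le, ← Real.rpow_natCast]
    norm_num
  have h3 : (OPT ^ (1 / 3 : ℝ)) ^ 3 = OPT := by
    rw [← Real.rpow_natCast, ← Real.rpow_mul hO.le]
    norm_num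
  rw [mul_pow (_ / _), div_pow, h2, h3] at h1
  have h4 : D * ℓ * Real.log ℓ * (m : ℝ) ^ 2 ≤ D * ℓ ^ 3 * m ^ 3 := by
    calc D * ℓ * Real.log ℓ * (m : ℝ) ^ 2 ≤ D * ℓ * ℓ * (m : ℝ) ^ 2 := by gcongr
      _ = D * ℓ ^ 2 * m ^ 2 * (1 * 1) := by ring
      _ ≤ D * ℓ ^ 2 * m ^ 2 * (ℓ * m) := by gcongr <;> linarith
      _ = _ := by ring
  have h5 : D ^ 2 * (D * ℓ ^ 3 * m ^ 3) ≤ D ^ 2 * (OPT / 100 ^ 3) := by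
    calc _ = (D * ℓ * m) ^ 3 := by ring
      _ ≤ D₀ ^ 2 / 100 ^ 3 * OPT := h1
      _ ≤ D ^ 2 / 100 ^ 3 * OPT := by gcongr
      _ = _ := by ring
  have h6 := le_of_mul_le_mul_left h5 (by positivity)
  have h7 := gammaParam_pow_three_mul (m := m) (by positivity : 0 ≤ D * ℓ * Real.log ℓ) hO
  have h8 : gammaParam D ℓ m OPT ^ 3 * OPT ≤ (1 / 100) ^ 3 * OPT := by
    rw [h7]
    linarith
  exact le_of_pow_le_pow_left₀ three_ne_zero (by norm_num) (le_of_mul_le_mul_right h8 hO)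

theorem log_one_sub_bound {γ : ℝ} (h0 : 0 ≤ γ) (h1 : γ ≤ 1 / 100) :
    -Real.log (1 - γ) ≤ γ * (1 + 2 * γ) := by
  have h2 : 0 < 1 - γ := by linarith
  have h3 := Real.one_sub_inv_le_log_of_pos h2
  have h4 : (1 - γ)⁻¹ ≤ 1 + γ * (1 + 2 * γ) := by
    rw [inv_le_iff_one_le_mul₀ h2]
    nlinarith [mul_nonneg h0 h0, mul_nonneg (mul_nonneg h0 h0) (sub_nonneg.2 h1)]
  linarith

end params

/-! ### Assembly of the bound -/

theorem expectedCost_le {M : Type*} [MetricSpace M] {ℓ : ℕ} [NeZero ℓ] (I : Instance M ℓ)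
    {R : (Fin ℓ → ℝ) → (Fin ℓ → ℝ) → Fin ℓ → PMF (Fin ℓ)} {greedy : ℕ → M → M}
    {D ε γ : ℝ} {m : ℕ} (hR : IsRound R) (hgreedy : IsGreedy I greedy) (hℓ : 2 ≤ ℓ) (hm : 2 ≤ m)
    (hdiam : ∀ a b : M, edist a b ≤ ENNReal.ofReal D) (hD : 0 < D)
    (hf : ∀ t ∈ Finset.Icc 1 I.T, ∀ i, I.f t i ≤ ENNReal.ofReal (2 * D))
    (hO : 0 < I.opt.toReal) (hγ0 : 0 < γ) (hγ1 : γ ≤ 1 / 100) (hε : γ = (m : ℝ) ^ 2 * ε)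
    (hγ : D * ℓ * Real.log ℓ * (m : ℝ) ^ 2 = γ ^ 3 * I.opt.toReal) :
    I.expectedCost greedy R D m ε (-Real.log (1 - γ)) ≤
      I.opt + ENNReal.ofReal (100 * (γ * I.opt.toReal)) := by
  set η := -Real.log (1 - γ) with hη
  have hexp : Real.exp (-η) = 1 - γ := by rw [hη, neg_neg, Real.exp_log (by linarith)]
  have hη0 := nonneg_of_exp_neg hexp hγ0.le
  have hℓ' : (2 : ℝ) ≤ ℓ := by exact_mod_cast hℓ
  have hm' : (2 : ℝ) ≤ m := by exact_mod_cast hm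
  have hmsq : 2 * (m : ℝ) ≤ (m : ℝ) ^ 2 := by nlinarith
  have hε0 : 0 < ε := by
    by_contra hcon
    have : (m : ℝ) ^ 2 * ε ≤ 0 := mul_nonpos_of_nonneg_of_nonpos (sq_nonneg _) (not_lt.1 hcon)
    linarith
  have h2mε : 2 * m * ε ≤ γ := by
    rw [hε]
    exact mul_le_mul_of_nonneg_right hmsq hε0.le
  have hmε : m * ε ≤ γ := by
    have : 0 ≤ m * ε := by positivity
    linarith
  have hε1 : ε ≤ 1 := by nlinarith
  have hf0 := I.realCost_nonneg
  have hf1 := I.realCost_le hD.le hf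
  obtain ⟨i, hi⟩ := exists_eq_ciInf_of_finite (f := fun i => ∑ t ∈ Finset.Icc 1 I.T, I.f t i)
  have hopt : I.opt.toReal = ∑ t ∈ Finset.range (I.T + 1), I.realCost t i := by
    rw [Instance.opt, ← hi, ENNReal.toReal_sum fun t ht =>
      ne_top_of_le_ne_top ENNReal.ofReal_ne_top (hf t ht i)]
    symm
    simp only [Instance.realCost]
    rw [← Finset.sum_subset (s₁ := Finset.Icc 1 I.T) (fun t ht => ?_) fun t _ ht => if_neg ht]
    · exact Finset.sum_congr rfl fun t ht => if_pos ht
    · rw [Finset.mem_Icc] at ht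
      exact Finset.mem_range.2 (by omega)
  have hopt_ne : I.opt ≠ ∞ := fun h => by rw [h] at hO; exact lt_irrefl _ hO
  have hlog : 1 ≤ ℓ * Real.log ℓ := by
    have h1 := Real.one_sub_inv_le_log_of_pos (show (0 : ℝ) < ℓ by linarith)
    have h2 := mul_le_mul_of_nonneg_left h1 (show (0 : ℝ) ≤ ℓ by linarith)
    rw [mul_sub, mul_inv_cancel₀ (by linarith)] at h2
    linarith
  refine (expectedCost_le_ofReal_expect I hR hdiam hD.le hf hgreedy hm ε).trans ?_
  rw [← ENNReal.ofReal_toReal hopt_ne, ← ENNReal.ofReal_add hO.le (by positivity),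
    ENNReal.toReal_ofReal hO.le]
  refine ENNReal.ofReal_le_ofReal ?_
  have hG := sum_expect_meanLoss_le (T := I.T) (m := m) hD hf0 hf1 hexp hγ0.le hε0.le hε1 i
  have hX := sum_expect_meanCost_le (T := I.T) hD hf0 hf1 hexp hγ0.le hγ1 hε0.le hε1
    (by omega : 1 ≤ m) hmε
  have hT := sum_expect_movedMass_le (T := I.T) (ε := ε) (m := m) hD hf0 hη0
  have hV := sum_expect_backlog_le (T := I.T) hD hf0 hf1 hexp hγ0.le hγ1 hε0.le hε1
    (by omega : 1 ≤ m) h2mε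
  rw [← hopt] at hG
  refine le_trans (le_of_eq ?_) (total_cost_le hm' hℓ' hlog hD hO hγ0 hγ1 hε hη0
    (log_one_sub_bound hγ0.le hγ1) (Finset.sum_nonneg fun t _ => expect_nonneg fun β e =>
      meanLoss_nonneg hD hf0 t β e) hγ hG hX hT hV)
  simp only [meanStep, expect_sum, expect_add, expect_const_mul, Finset.sum_add_distrib,
    Finset.mul_sum]

end BanditMTS

end

theorem theorem1 :
    ∃ C : ℝ, 0 < C ∧ ∀ D₀ : ℝ, 0 < D₀ → ∃ κ : ℝ, 0 < κ ∧
      ∀ (M : Type*) [MetricSpace M] [BoundedSpace M] (ℓ m : ℕ) (I : BanditMTS.Instance M ℓ)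
        (greedy : ℕ → M → M) (R : (Fin ℓ → ℝ) → (Fin ℓ → ℝ) → Fin ℓ → PMF (Fin ℓ)) (D OPT : ℝ),
        2 ≤ ℓ → 2 ≤ m →
        D = Metric.diam (Set.univ : Set M) → D₀ ≤ D →
        (∀ t ∈ Finset.Icc 1 I.T, ∀ i, I.f t i ≤ ENNReal.ofReal (2 * D)) →
        OPT = I.opt.toReal →
        BanditMTS.IsGreedy I greedy →
        BanditMTS.IsRound R →
        D * ℓ * m ≤ κ * OPT ^ (1 / 3 : ℝ) →
        (0 < BanditMTS.epsParam D ℓ m OPT ∧ BanditMTS.epsParam D ℓ m OPT < 1) ∧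
        (0 < BanditMTS.gammaParam D ℓ m OPT ∧ BanditMTS.gammaParam D ℓ m OPT < 1) ∧
        I.expectedCost greedy R D m (BanditMTS.epsParam D ℓ m OPT)
            (BanditMTS.etaParam D ℓ m OPT) ≤
          I.opt + ENNReal.ofReal (C * ((D * ℓ * Real.log ℓ) ^ (1 / 3 : ℝ) *
            (m : ℝ) ^ (2 / 3 : ℝ) * OPT ^ (2 / 3 : ℝ))) := by
  refine ⟨100, by norm_num, fun D₀ hD₀ => ⟨D₀ ^ (2 / 3 : ℝ) / 100, by positivity, ?_⟩⟩
  intro M _ _ ℓ m I greedy R D OPT hℓ hm hD hD₀D hf hOPT hgreedy hR hκ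
  have hDpos : 0 < D := hD₀.trans_le hD₀D
  have hℓ' : (2 : ℝ) ≤ ℓ := by exact_mod_cast hℓ
  have hm' : (2 : ℝ) ≤ m := by exact_mod_cast hm
  have hlog : 0 < Real.log ℓ := Real.log_pos (by linarith)
  -- If OPT were 0, the right side of the smallness hypothesis would vanish, while D ℓ m > 0. An
  -- infinite optimum is excluded as well, since its `toReal` is 0.
  have hO : 0 < OPT := by
    rcases (hOPT ▸ ENNReal.toReal_nonneg : 0 ≤ OPT).eq_or_lt with h | h
    · rw [← h, Real.zero_rpow (by norm_num), mul_zero] at hκ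
      have : 0 < D * ℓ * m := by positivity
      linarith
    · exact h
  have ha : 0 < D * ℓ * Real.log ℓ := by positivity
  have hγ1 := BanditMTS.gammaParam_le hD₀ hD₀D hℓ hm hO hκ
  have hε0 : 0 < BanditMTS.epsParam D ℓ m OPT := by unfold BanditMTS.epsParam; positivity
  have hγ0 : 0 < BanditMTS.gammaParam D ℓ m OPT := by unfold BanditMTS.gammaParam; positivity
  have hγε := BanditMTS.gammaParam_eq_sq_mul_epsParam (D := D) (OPT := OPT) (ℓ := ℓ)
    (show 0 < m by omega)
  have hε1 : BanditMTS.epsParam D ℓ m OPT < 1 := by nlinarith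
  refine ⟨⟨hε0, hε1⟩, ⟨hγ0, by linarith⟩, ?_⟩
  have hdiam : ∀ a b : M, edist a b ≤ ENNReal.ofReal D := by
    intro a b
    rw [edist_dist, hD]
    exact ENNReal.ofReal_le_ofReal (Metric.dist_le_diam_of_mem
      (Bornology.IsBounded.all _) (Set.mem_univ a) (Set.mem_univ b))
  have : NeZero ℓ := ⟨by omega⟩
  rw [← BanditMTS.gammaParam_mul_opt hO, BanditMTS.etaParam]
  have hγ := (BanditMTS.gammaParam_pow_three_mul (m := m) ha.le hO).symm
  subst hOPT
  exact BanditMTS.expectedCost_le I hR hgreedy hℓ hm hdiam hDpos hf hO hγ0 hγ1 hγε hγ
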